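/- Let $M$ be a connected smooth manifold of dimension $n$ and let $F_0:M\hookrightarrow\mathbb S^{n+1}\subset\mathbb R^{n+2}$ be an isoparametric hypersurface: a smooth embedding with a smooth unit normal field $\nu_0$ (tangent to $\mathbb S^{n+1}$ and normal to $M$) whose principal curvatures are constant. For $t\in\mathbb R$ put $$F_t=\cos(t)F_0+\sin(t)\nu_0,\qquad \nu_t=-\sin(t)F_0+\cos(t)\nu_0 .$$ Call $t$ regular, $t\in\mathcal R$, if $F_t$ is an immersion (i.e. $F_t$ has no focal points). For $t\in\mathcal R$ let $g_t$ be the metric on $M$ induced by $F_t$, $\nabla^t$ its Levi-Civita connection, $A_t$ the shape operator of $F_t$ with respect to $\nu_t$ (so $d\nu_t=-dF_t\,A_t$), and for smooth vector fields $X,Y,Z$ on $M$ let $$\alpha^t(X,Y,Z)=g_t\big((\nabla^t_XA_t)Y,Z\big).$$ Let $Q_n=\{[z]\in\mathbb{CP}^{n+1}: z_0^2+\dots+z_{n+1}^2=0\}\cong Gr_2^+(\mathbb R^{n+2})$ be the complex quadric with complex structure $J$ and with the K\"ahler metric $g_Q$ induced by the Fubini-Study metric (normalized so that $\mathbb S^{2n+3}\to\mathbb{CP}^{n+1}$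 is a Riemannian submersion), and let $$\mathfrak L:M\to Q_n,\qquad \mathfrak L(p)=\Big[\tfrac1{\sqrt2}\big(F_0(p)+i\,\nu_0(p)\big)\Big]$$ be the associated Lagrangian immersion. Let $\hat g=\mathfrak L^*g_Q$, let $N_X=-J\,d\mathfrak L(X)$ be the normal field along $\mathfrak L$ associated with $X$, let $\hat A_\xi$ be the shape operator of $\mathfrak L$ with respect to a normal field $\xi$, i.e. $\hat g(\hat A_\xi Y,Z)=-g_Q(\nabla^{Q}_Y\xi,d\mathfrak L Z)$ with $\nabla^Q$ the Levi-Civita connection of $g_Q$, and let $$\hat\alpha(X,Y,Z)=\hat g(\hat A_{N_X}Y,Z)$$ be the second fundamental form of $\mathfrak L$. Then for every $t\in\mathcal R$ and all smooth vector fields $X,Y,Z$ on $M$ $$\alpha^t(X,Y,Z)=2\,\hat\alpha(X,Y,Z).$$ In particular $\alpha^t$ does not depend on $t\in\mathcal R$. -/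

import Mathlib

open Topology
open scoped Manifold ContDiff LinearAlgebra.Projectivization

noncomputable section

/-! ### Riemannian geometry: the Levi-Civita derivative along a map, shape operators -/

section Riemannian

variable {E : Type*} [NormedAddCommGroup E] [NormedSpace ℝ E]
  {M : Type*} [TopologicalSpace M] [ChartedSpace E M]
  {F : Type*} [NormedAddCommGroup F] [NormedSpace ℝ F]
  {N : Type*} [TopologicalSpace N] [ChartedSpace F N]

variable (F N) in
/-- A field of bilinear forms on the tangent spaces of a manifold `N` modelled on `F`. -/
abbrev MetricTensor : Type _ :=
  (y : N) → TangentSpace 𝓘(ℝ, F) y →L[ℝ] TangentSpace 𝓘(ℝ, F) y →L[ℝ] ℝ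

/-- The expression of the metric `g` in the chart centred at `x`, at the point of `N` that has
the coordinates `u`. -/
def metricInChart (g : MetricTensor F N) (x : N) (u : F) : F →L[ℝ] F →L[ℝ] ℝ :=
  let D : F →L[ℝ] TangentSpace 𝓘(ℝ, F) ((extChartAt 𝓘(ℝ, F) x).symm u) :=
    mfderiv 𝓘(ℝ, F) 𝓘(ℝ, F) (extChartAt 𝓘(ℝ, F) x).symm u
  ContinuousLinearMap.precomp ℝ D ∘L g ((extChartAt 𝓘(ℝ, F) x).symm u) ∘L D

/-- The Christoffel symbols `Γ(a, b)` of the metric `g` at `x`, in the chart centred at `x`: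
`g(Γ(a, b), c) = (∂_a g(b, c) + ∂_b g(a, c) - ∂_c g(a, b)) / 2`. -/
def christoffel (g : MetricTensor F N) (x : N) (a b : F) : F :=
  let u : F := extChartAt 𝓘(ℝ, F) x x
  let dg : F →L[ℝ] F →L[ℝ] F →L[ℝ] ℝ := fderiv ℝ (metricInChart g x) u
  (metricInChart g x u).inverse ((1 / 2 : ℝ) • (dg a b + dg b a - (dg.flip a).flip b))

/-- The coordinates of a tangent vector `w` at `y` in the chart centred at `x`. -/
def tangentCoord (x y : N) (w : TangentSpace 𝓘(ℝ, F) y) : F :=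
  mfderiv 𝓘(ℝ, F) 𝓘(ℝ, F) (extChartAt 𝓘(ℝ, F) x) y w

/-- The covariant derivative `∇_v V` at `p`, with respect to the Levi-Civita connection of the
metric `g` of `N`, of a vector field `V` along a map `f : M → N`. In the chart centred at `f p` it
is `∂_v V + Γ(df v, V)`. -/
def covDerivAlong (g : MetricTensor F N) (f : M → N)
    (V : (q : M) → TangentSpace 𝓘(ℝ, F) (f q)) (p : M) (v : TangentSpace 𝓘(ℝ, E) p) :
    TangentSpace 𝓘(ℝ, F) (f p) :=
  let x : N := f p
  let c : F := mvfderiv 𝓘(ℝ, E) (fun q => tangentCoord x (f q) (V q)) p v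
    + christoffel g x (tangentCoord x x (mfderiv 𝓘(ℝ, E) 𝓘(ℝ, F) f p v))
        (tangentCoord x x (V p))
  (mfderiv 𝓘(ℝ, F) 𝓘(ℝ, F) (extChartAt 𝓘(ℝ, F) x) x).inverse c

/-- The Levi-Civita connection `∇_X Y` of the metric `g` of `M`. -/
def leviCivita (g : MetricTensor E M) (X Y : (p : M) → TangentSpace 𝓘(ℝ, E) p) (p : M) :
    TangentSpace 𝓘(ℝ, E) p :=
  covDerivAlong g (fun q : M => q) Y p (X p)

/-- The metric `f^* g`. -/
def pullbackMetric (g : MetricTensor F N) (f : M → N) : MetricTensor E M := fun p =>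
  ContinuousLinearMap.precomp ℝ (mfderiv 𝓘(ℝ, E) 𝓘(ℝ, F) f p) ∘L
    g (f p) ∘L mfderiv 𝓘(ℝ, E) 𝓘(ℝ, F) f p

/-- The shape operator at `p` of an immersion `f : M → N` into a manifold with metric `g`,
with respect to a normal vector field `ξ` along `f`: it is `A_ξ v = - (∇_v ξ)^T`, that is,
`(f^* g)(A_ξ v, w) = - g(∇_v ξ, df w)` for all `w`. -/
def shapeOperatorAlong (g : MetricTensor F N) (f : M → N)
    (ξ : (q : M) → TangentSpace 𝓘(ℝ, F) (f q)) (p : M) (v : TangentSpace 𝓘(ℝ, E) p) :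
    TangentSpace 𝓘(ℝ, E) p :=
  (pullbackMetric (E := E) g f p).inverse
    (-((g (f p) (covDerivAlong g f ξ p v)).comp (mfderiv 𝓘(ℝ, E) 𝓘(ℝ, F) f p)))

end Riemannian

/-! ### The complex quadric -/

/-- `ℂ^{n+2}` -/
abbrev CSpace (n : ℕ) : Type := EuclideanSpace ℂ (Fin (n + 2))

/-- The standard complex bilinear form of `ℂ^{n+2}`. -/
def cBilin {n : ℕ} (z w : CSpace n) : ℂ := ∑ i, z i * w i

/-- Entrywise complex conjugation. -/
def cConj {n : ℕ} (z : CSpace n) : CSpace n := WithLp.toLp 2 fun i => (starRingEnd ℂ) (z i)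

/-- The nonzero isotropic vectors of `ℂ^{n+2}`. -/
abbrev IsotropicCone (n : ℕ) : Type := {z : CSpace n // z ≠ 0 ∧ cBilin z z = 0}

/-- The complex quadric `Q_n ⊂ ℂP^{n+1}`, given by `z_0^2 + ... + z_{n+1}^2 = 0`. -/
@[ext]
structure Quadric (n : ℕ) : Type where
  pt : ℙ ℂ (CSpace n)
  isotropic : cBilin pt.rep pt.rep = 0

namespace Quadric

variable {n : ℕ}

lemma cBilin_smul (c : ℂ) (z : CSpace n) : cBilin (c • z) (c • z) = c ^ 2 * cBilin z z := by
  simp only [cBilin, PiLp.smul_apply, smul_eq_mul, Finset.mul_sum]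
  exact Finset.sum_congr rfl fun i _ => by ring

/-- The natural projection `π`, restricted to the isotropic vectors. -/
def proj (z : IsotropicCone n) : Quadric n where
  pt := Projectivization.mk ℂ z.1 z.2.1
  isotropic := by
    obtain ⟨a, ha⟩ := Projectivization.exists_smul_eq_mk_rep ℂ z.1 z.2.1
    rw [← ha, Units.smul_def, cBilin_smul, z.2.2, mul_zero]

/-- The quotient topology. -/
instance : TopologicalSpace (Quadric n) := TopologicalSpace.coinduced proj inferInstance

lemma proj_eq_iff {z w : IsotropicCone n} : proj z = proj w ↔ ∃ a : ℂ, a • w.1 = z.1 := by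
  rw [Quadric.ext_iff]
  exact Projectivization.mk_eq_mk_iff' ℂ _ _ _ _

/-- A nonzero isotropic vector representing `q`. -/
def rep (q : Quadric n) : IsotropicCone n := ⟨q.pt.rep, q.pt.rep_nonzero, q.isotropic⟩

lemma proj_rep (q : Quadric n) : proj q.rep = q := Quadric.ext q.pt.mk_rep

lemma continuous_proj : Continuous (proj (n := n)) := continuous_coinduced_rng

lemma proj_eq_proj_iff_smul {z w : IsotropicCone n} :
    proj z = proj w ↔ ∃ a : ℂ, a ≠ 0 ∧ z.1 = a • w.1 := by
  rw [proj_eq_iff]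
  constructor
  · rintro ⟨a, ha⟩
    refine ⟨a, ?_, ha.symm⟩
    rintro rfl
    exact z.2.1 (by rw [← ha, zero_smul])
  · rintro ⟨a, -, ha⟩
    exact ⟨a, ha.symm⟩

lemma rep_proj (z : IsotropicCone n) : ∃ a : ℂ, a ≠ 0 ∧ (proj z).rep.1 = a • z.1 :=
  proj_eq_proj_iff_smul.1 (proj_rep _)

end Quadric

section Bilinear

variable {n : ℕ}

lemma cBilin_add_left (x y z : CSpace n) : cBilin (x + y) z = cBilin x z + cBilin y z := by
  simp [cBilin, add_mul, Finset.sum_add_distrib]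

lemma cBilin_smul_left (c : ℂ) (x z : CSpace n) : cBilin (c • x) z = c * cBilin x z := by
  simp [cBilin, mul_assoc, Finset.mul_sum]

lemma cBilin_comm (x y : CSpace n) : cBilin x y = cBilin y x := by
  simp [cBilin, mul_comm]

lemma cBilin_eq_inner (x y : CSpace n) : cBilin x y = inner ℂ (cConj x) y := by
  simp [cBilin, cConj, PiLp.inner_apply, mul_comm]

lemma cConj_cConj (x : CSpace n) : cConj (cConj x) = x := by
  ext i; simp [cConj]

end Bilinear

/-- An orthonormal basis of the hermitian space `ℂ^{n+2}` whose first vector is isotropic and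
whose second vector is the complex conjugate of the first. -/
structure IsotropicFrame (n : ℕ) where
  basis : OrthonormalBasis (Fin (n + 2)) ℂ (CSpace n)
  isotropic : cBilin (basis 0) (basis 0) = 0
  conj : basis 1 = cConj (basis 0)

namespace IsotropicFrame

open Quadric

variable {n : ℕ} (b : IsotropicFrame n)

/-- The combination of the basis vectors other than the first two. -/
def tang (u : EuclideanSpace ℂ (Fin n)) : CSpace n := ∑ i, u i • b.basis i.succ.succ

/-- The isotropic vectors whose first coordinate in the frame is `1`, parametrized by the
coordinates other than the first two. -/
def param (u : EuclideanSpace ℂ (Fin n)) : CSpace n :=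
  b.basis 0 + b.tang u - ((1 / 2 : ℂ) * cBilin (b.tang u) (b.tang u)) • b.basis 1

/-- Affine coordinates. -/
def coord (z : CSpace n) : EuclideanSpace ℂ (Fin n) :=
  WithLp.toLp 2 fun i => b.basis.repr z i.succ.succ / b.basis.repr z 0

lemma bilin_zero_one : cBilin (b.basis 0) (b.basis 1) = 1 := by
  rw [cBilin_eq_inner, ← b.conj]
  simp

lemma bilin_one_one : cBilin (b.basis 1) (b.basis 1) = 0 := by
  rw [cBilin_eq_inner, b.conj, cConj_cConj, ← b.conj]
  simp

lemma bilin_zero_tang (u : EuclideanSpace ℂ (Fin n)) : cBilin (b.basis 0) (b.tang u) = 0 := by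
  rw [cBilin_eq_inner, ← b.conj, tang, inner_sum]
  refine Finset.sum_eq_zero fun i _ => ?_
  rw [inner_smul_right, b.basis.inner_eq_zero, mul_zero]
  exact fun h => by simpa using congrArg Fin.val h

lemma bilin_one_tang (u : EuclideanSpace ℂ (Fin n)) : cBilin (b.basis 1) (b.tang u) = 0 := by
  rw [cBilin_eq_inner, b.conj, cConj_cConj, tang, inner_sum]
  refine Finset.sum_eq_zero fun i _ => ?_
  rw [inner_smul_right, b.basis.inner_eq_zero, mul_zero]
  exact fun h => by simpa using congrArg Fin.val h

lemma bilin_comb (a c : ℂ) (u : EuclideanSpace ℂ (Fin n)) :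
    cBilin (a • b.basis 0 + c • b.basis 1 + b.tang u) (a • b.basis 0 + c • b.basis 1 + b.tang u)
      = 2 * (a * c) + cBilin (b.tang u) (b.tang u) := by
  have hr (x y z : CSpace n) : cBilin x (y + z) = cBilin x y + cBilin x z := by
    rw [cBilin_comm, cBilin_add_left, cBilin_comm y, cBilin_comm z]
  have hs (k : ℂ) (x y : CSpace n) : cBilin x (k • y) = k * cBilin x y := by
    rw [cBilin_comm, cBilin_smul_left, cBilin_comm]
  simp only [cBilin_add_left, cBilin_smul_left, hr, hs, b.isotropic, b.bilin_zero_one,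
    b.bilin_one_one, b.bilin_zero_tang, b.bilin_one_tang, cBilin_comm (b.basis 1) (b.basis 0),
    cBilin_comm (b.tang u) (b.basis 0), cBilin_comm (b.tang u) (b.basis 1)]
  ring

lemma param_eq (u : EuclideanSpace ℂ (Fin n)) : b.param u = (1 : ℂ) • b.basis 0 +
    (-((1 / 2 : ℂ) * cBilin (b.tang u) (b.tang u))) • b.basis 1 + b.tang u := by
  rw [param]; module

lemma bilin_param (u : EuclideanSpace ℂ (Fin n)) : cBilin (b.param u) (b.param u) = 0 := by
  rw [param_eq, bilin_comb]; ring

lemma repr_comb (a c : ℂ) (u : EuclideanSpace ℂ (Fin n)) (j : Fin (n + 2)) :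
    b.basis.repr (a • b.basis 0 + c • b.basis 1 + b.tang u) j
      = (Fin.cons a (Fin.cons c u.ofLp) : Fin (n + 2) → ℂ) j := by
  have : a • b.basis 0 + c • b.basis 1 + b.tang u
      = ∑ j, (Fin.cons a (Fin.cons c u.ofLp) : Fin (n + 2) → ℂ) j • b.basis j := by
    simp [Fin.sum_univ_succ, tang, add_assoc]
  rw [this, OrthonormalBasis.repr_apply_apply, inner_sum, Finset.sum_eq_single j]
  · simp [inner_smul_right]
  · intro i _ hij
    rw [inner_smul_right, b.basis.inner_eq_zero hij.symm, mul_zero]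
  · simp

lemma repr_param_zero (u : EuclideanSpace ℂ (Fin n)) : b.basis.repr (b.param u) 0 = 1 := by
  rw [param_eq, repr_comb]; simp

lemma param_ne_zero (u : EuclideanSpace ℂ (Fin n)) : b.param u ≠ 0 := fun h => by
  have := b.repr_param_zero u
  simp [h] at this

lemma coord_param (u : EuclideanSpace ℂ (Fin n)) : b.coord (b.param u) = u := by
  ext i
  have h := b.repr_param_zero u
  simp only [coord, h, div_one]
  rw [param_eq, repr_comb]; simp

lemma coord_smul {a : ℂ} (ha : a ≠ 0) (z : CSpace n) : b.coord (a • z) = b.coord z := by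
  ext i
  simp [coord, mul_div_mul_left _ _ ha]

lemma param_coord {z : CSpace n} (hz : cBilin z z = 0) (h0 : b.basis.repr z 0 ≠ 0) :
    b.param (b.coord z) = (b.basis.repr z 0)⁻¹ • z := by
  set a := b.basis.repr z 0 with ha
  set c := b.basis.repr z 1 with hc
  have ht : a • b.tang (b.coord z) = ∑ i : Fin n, b.basis.repr z i.succ.succ • b.basis i.succ.succ := by
    rw [tang, Finset.smul_sum]
    refine Finset.sum_congr rfl fun i _ => ?_
    rw [smul_smul]
    congr 1
    simp only [coord, ← ha]
    field_simp
  have hsum : z = a • b.basis 0 + c • b.basis 1 + a • b.tang (b.coord z) := by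
    conv_lhs => rw [← b.basis.sum_repr z]
    rw [ht, Fin.sum_univ_succ, Fin.sum_univ_succ]
    exact (add_assoc _ _ _).symm
  have htang : a • b.tang (b.coord z) = b.tang (a • b.coord z) := by
    simp [tang, Finset.smul_sum, smul_smul]
  have hb : 2 * (a * c) + a ^ 2 * cBilin (b.tang (b.coord z)) (b.tang (b.coord z)) = 0 := by
    rw [← cBilin_smul, htang, ← bilin_comb, ← htang, ← hsum, hz]
  have hc' : -((1 / 2 : ℂ) * cBilin (b.tang (b.coord z)) (b.tang (b.coord z))) = a⁻¹ * c := by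
    field_simp
    have := mul_left_cancel₀ h0 (show a * (a * cBilin (b.tang (b.coord z)) (b.tang (b.coord z)))
      = a * (-(2 * c)) by linear_combination hb)
    linear_combination -this
  rw [param_eq, hc']
  conv_rhs => rw [hsum]
  simp [smul_add, smul_smul, h0]

lemma contDiff_param {m : ℕ∞ω} : ContDiff ℂ m b.param := by
  unfold param tang cBilin
  simp only [WithLp.ofLp_sum, PiLp.smul_apply, Finset.sum_apply]
  fun_prop

lemma contDiffOn_coord {m : ℕ∞ω} : ContDiffOn ℂ m b.coord {z | b.basis.repr z 0 ≠ 0} := by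
  unfold coord
  have h : ∀ i, ContDiff ℂ m fun z => b.basis.repr z i := fun i => by fun_prop
  rw [contDiffOn_euclidean]
  intro i
  exact (h _).contDiffOn.div (h _).contDiffOn fun z hz => hz

lemma exists_frame (z : IsotropicCone n) :
    ∃ b : IsotropicFrame n, b.basis 0 = ((‖z.1‖⁻¹ : ℝ) : ℂ) • z.1 := by
  set z₀ : CSpace n := ((‖z.1‖⁻¹ : ℝ) : ℂ) • z.1 with hz₀
  have hn : ‖z₀‖ = 1 := by
    rw [hz₀, norm_smul]
    have : ‖z.1‖ ≠ 0 := norm_ne_zero_iff.2 z.2.1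
    simp [this]
  have hi : cBilin z₀ z₀ = 0 := by rw [hz₀, cBilin_smul, z.2.2, mul_zero]
  have hn' : ‖cConj z₀‖ = 1 := by
    rw [← hn, EuclideanSpace.norm_eq, EuclideanSpace.norm_eq]
    simp [cConj]
  have ho : inner ℂ (cConj z₀) z₀ = 0 := by rw [← cBilin_eq_inner, hi]
  let v : Fin (n + 2) → CSpace n := Fin.cons z₀ (Fin.cons (cConj z₀) fun _ => 0)
  have hv : Orthonormal ℂ (({0, 1} : Set (Fin (n + 2))).domRestrict v) := by
    refine ⟨?_, ?_⟩
    · rintro ⟨i, rfl | rfl⟩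
      · exact hn
      · exact hn'
    · rintro ⟨i, rfl | rfl⟩ ⟨j, rfl | rfl⟩ hij
      · exact absurd rfl hij
      · exact inner_eq_zero_symm.1 ho
      · exact ho
      · exact absurd rfl hij
  obtain ⟨b, hb⟩ := hv.exists_orthonormalBasis_extension_of_card_eq (by simp)
  have hb0 : b 0 = z₀ := hb 0 (by simp)
  have hb1 : b 1 = cConj z₀ := hb 1 (by simp)
  exact ⟨⟨b, by rw [hb0, hi], by rw [hb0, hb1]⟩, hb0⟩

/-- The point of the quadric with given affine coordinates. -/
def toQuadric (u : EuclideanSpace ℂ (Fin n)) : Quadric n :=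
  proj ⟨b.param u, b.param_ne_zero u, b.bilin_param u⟩

lemma repr_rep_ne_zero_iff (z : IsotropicCone n) :
    b.basis.repr (proj z).rep.1 0 ≠ 0 ↔ b.basis.repr z.1 0 ≠ 0 := by
  obtain ⟨a, ha, h⟩ := rep_proj z
  simp [h, ha]

lemma coord_rep (z : IsotropicCone n) : b.coord (proj z).rep.1 = b.coord z.1 := by
  obtain ⟨a, ha, h⟩ := rep_proj z
  rw [h, b.coord_smul ha]

lemma isOpen_source : IsOpen {q : Quadric n | b.basis.repr q.rep.1 0 ≠ 0} := by
  rw [isOpen_coinduced]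
  have : proj ⁻¹' {q : Quadric n | b.basis.repr q.rep.1 0 ≠ 0}
      = {z : IsotropicCone n | b.basis.repr z.1 0 ≠ 0} := by
    ext z; exact b.repr_rep_ne_zero_iff z
  rw [this]
  exact isOpen_ne_fun (by fun_prop) continuous_const

/-- The chart of the quadric given by the affine coordinates `[z] ↦ (z_2 / z_0, ...,
z_{n+1} / z_0)`, with respect to an isotropic frame. -/
def chart : OpenPartialHomeomorph (Quadric n) (EuclideanSpace ℂ (Fin n)) where
  toFun q := b.coord q.rep.1
  invFun := b.toQuadric
  source := {q | b.basis.repr q.rep.1 0 ≠ 0}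
  target := Set.univ
  map_source' _ _ := Set.mem_univ _
  map_target' u _ := by
    refine (b.repr_rep_ne_zero_iff _).2 ?_
    rw [b.repr_param_zero]
    exact one_ne_zero
  left_inv' q hq := by
    conv_rhs => rw [← proj_rep q]
    exact proj_eq_iff.2 ⟨_, (b.param_coord q.rep.2.2 hq).symm⟩
  right_inv' u _ := by
    rw [toQuadric, coord_rep, b.coord_param]
  open_source := b.isOpen_source
  open_target := isOpen_univ
  continuousOn_toFun := by
    have hq : IsQuotientMap (proj (n := n)) := ⟨⟨rfl⟩, fun q => ⟨q.rep, proj_rep q⟩⟩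
    rw [hq.continuousOn_isOpen_iff b.isOpen_source]
    have : b.coord ∘ (fun q : Quadric n => q.rep.1) ∘ proj = fun z => b.coord z.1 :=
      funext fun z => b.coord_rep z
    change ContinuousOn (b.coord ∘ (fun q : Quadric n => q.rep.1) ∘ proj) _
    rw [this]
    refine (b.contDiffOn_coord (m := 0)).continuousOn.comp continuous_subtype_val.continuousOn ?_
    exact fun z hz => (b.repr_rep_ne_zero_iff z).1 hz
  continuousOn_invFun := by
    refine (continuous_proj.comp ?_).continuousOn
    exact (b.contDiff_param (m := 0)).continuous.subtype_mk _

/-- Coordinate changes are holomorphic. -/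
lemma contDiffOn_change (b' : IsotropicFrame n) {m : ℕ∞ω} :
    ContDiffOn ℂ m (b.chart.symm ≫ₕ b'.chart) (b.chart.symm ≫ₕ b'.chart).source := by
  have h : Set.EqOn (b.chart.symm ≫ₕ b'.chart) (b'.coord ∘ b.param)
      (b.chart.symm ≫ₕ b'.chart).source := fun u _ => b'.coord_rep _
  refine (b'.contDiffOn_coord.comp b.contDiff_param.contDiffOn ?_).congr h
  intro u hu
  rw [OpenPartialHomeomorph.trans_source] at hu
  exact (b'.repr_rep_ne_zero_iff _).1 hu.2

end IsotropicFrame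

namespace Quadric

variable {n : ℕ}

/-- An isotropic frame whose first vector represents `q`. -/
def frame (q : Quadric n) : IsotropicFrame n := (IsotropicFrame.exists_frame q.rep).choose

lemma frame_zero (q : Quadric n) :
    q.frame.basis 0 = ((‖q.rep.1‖⁻¹ : ℝ) : ℂ) • q.rep.1 :=
  (IsotropicFrame.exists_frame q.rep).choose_spec

/-- The quadric as a manifold modelled on `ℂ^n`. -/
instance : ChartedSpace (EuclideanSpace ℂ (Fin n)) (Quadric n) where
  atlas := Set.range IsotropicFrame.chart
  chartAt q := q.frame.chart
  mem_chart_source q := by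
    change q.frame.basis.repr q.rep.1 0 ≠ 0
    have hne : q.rep.1 ≠ 0 := q.rep.2.1
    rw [OrthonormalBasis.repr_apply_apply, q.frame_zero, inner_smul_left]
    simp [hne]
  chart_mem_atlas q := ⟨q.frame, rfl⟩

/-- The quadric is a complex manifold. -/
instance : IsManifold 𝓘(ℂ, EuclideanSpace ℂ (Fin n)) ω (Quadric n) := by
  refine isManifold_of_contDiffOn _ _ _ ?_
  rintro _ _ ⟨b, rfl⟩ ⟨b', rfl⟩
  simpa using! b.contDiffOn_change b'

instance : IsManifold 𝓘(ℝ, EuclideanSpace ℂ (Fin n)) ω (Quadric n) := by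
  refine isManifold_of_contDiffOn _ _ _ ?_
  rintro _ _ ⟨b, rfl⟩ ⟨b', rfl⟩
  simpa using! (b.contDiffOn_change b').restrict_scalars ℝ

/-- A holomorphic local section of `π` near `q`, namely `[z] ↦ z / ⟨z₀, z⟩` where `z₀` is the unit
representative of `q` that is the first vector of the chosen frame. -/
def localLift (q y : Quadric n) : CSpace n := q.frame.param (q.frame.chart y)

/-- The Fubini-Study metric in homogeneous coordinates, as a bilinear form on `ℂ^{n+2}` for each
`z ≠ 0`: `Re ⟨u^⊥, v^⊥⟩ / ‖z‖²`, where `u^⊥` is the component of `u` that is hermitian orthogonal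
to `z`. Thus `π` is a Riemannian submersion on the unit sphere. -/
def fubiniStudy (z : CSpace n) : CSpace n →L[ℝ] CSpace n →L[ℝ] ℝ :=
  let P : CSpace n →L[ℝ] CSpace n := ((ℂ ∙ z)ᗮ.starProjection).restrictScalars ℝ
  (‖z‖ ^ 2)⁻¹ • (innerSL ℝ).bilinearComp P P

/-- The Kähler metric `g_Q` of the quadric, induced by the Fubini-Study metric: a tangent vector at
`q` is lifted by a local section of `π`, and the result does not depend on the section. -/
def kahlerMetric (n : ℕ) : MetricTensor (EuclideanSpace ℂ (Fin n)) (Quadric n) := fun q =>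
  let D := mvfderiv 𝓘(ℝ, EuclideanSpace ℂ (Fin n)) q.localLift q
  ContinuousLinearMap.precomp ℝ D ∘L fubiniStudy (q.localLift q) ∘L D

/-- The complex structure of the quadric. The charts are holomorphic, so that it is multiplication
by `i` in the chart centred at `q`. -/
def complexStructure (q : Quadric n) : TangentSpace 𝓘(ℝ, EuclideanSpace ℂ (Fin n)) q →L[ℝ]
    TangentSpace 𝓘(ℝ, EuclideanSpace ℂ (Fin n)) q :=
  (Complex.I • ContinuousLinearMap.id ℝ (EuclideanSpace ℂ (Fin n)) :
    EuclideanSpace ℂ (Fin n) →L[ℝ] EuclideanSpace ℂ (Fin n))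

end Quadric

/-! ### Hypersurfaces of the sphere -/

/-- `ℝ^{n+2}` -/
abbrev RSpace (n : ℕ) : Type := EuclideanSpace ℝ (Fin (n + 2))

section Hypersurface

variable {n : ℕ} {M : Type*} [TopologicalSpace M] [ChartedSpace (EuclideanSpace ℝ (Fin n)) M]

instance (p : M) : FiniteDimensional ℝ (TangentSpace (𝓡 n) p) :=
  inferInstanceAs (FiniteDimensional ℝ (EuclideanSpace ℝ (Fin n)))

/-- The Riemannian metric induced on `M` by a map into the sphere `S^{n+1} ⊂ ℝ^{n+2}`. -/
def inducedMetric (f : M → RSpace n) : MetricTensor (EuclideanSpace ℝ (Fin n)) M := fun p =>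
  let D := mvfderiv (𝓡 n) f p
  ContinuousLinearMap.precomp ℝ D ∘L innerSL ℝ ∘L D

/-- The shape operator of a hypersurface `f : M → S^{n+1}` with respect to the unit normal field
`ν`: `g(A v, w) = - ⟨dν v, df w⟩` for all `w`, that is, `dν = - df A`. -/
def shapeOperator (f ν : M → RSpace n) (p : M) :
    TangentSpace (𝓡 n) p →L[ℝ] TangentSpace (𝓡 n) p :=
  (inducedMetric f p).inverse ∘L
    (-(ContinuousLinearMap.precomp ℝ (mvfderiv (𝓡 n) f p) ∘L innerSL ℝ ∘L mvfderiv (𝓡 n) ν p))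

end Hypersurface

/-- An isoparametric hypersurface of `S^{n+1}`: an embedding `F : M → S^{n+1}` with a smooth unit
normal field `ν` (tangent to the sphere and normal to `M`) such that the principal curvatures,
counted with multiplicities, are constant. -/
structure IsoparametricHypersurface (n : ℕ) (M : Type*) [TopologicalSpace M]
    [ChartedSpace (EuclideanSpace ℝ (Fin n)) M] where
  F : M → Metric.sphere (0 : RSpace n) 1
  ν : M → RSpace n
  embedding : Manifold.IsSmoothEmbedding (𝓡 n) (𝓡 (n + 1)) ∞ F
  contMDiff_normal : ContMDiff (𝓡 n) 𝓘(ℝ, RSpace n) ∞ ν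
  norm_normal : ∀ p, ‖ν p‖ = 1
  inner_normal : ∀ p, inner ℝ (F p : RSpace n) (ν p) = 0
  normal : ∀ p (v : TangentSpace (𝓡 n) p),
    inner ℝ (mvfderiv (𝓡 n) (fun q => (F q : RSpace n)) p v) (ν p) = 0
  principalCurvature : Fin n → ℝ
  charpoly_shapeOperator : ∀ p,
    (shapeOperator (fun q => (F q : RSpace n)) ν p).toLinearMap.charpoly =
      ∏ i, (Polynomial.X - Polynomial.C (principalCurvature i))

namespace IsoparametricHypersurface

variable {n : ℕ} {M : Type*} [TopologicalSpace M] [ChartedSpace (EuclideanSpace ℝ (Fin n)) M]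
  (S : IsoparametricHypersurface n M)

/-- The parallel surface `F_t`. -/
def parallel (t : ℝ) (p : M) : RSpace n := Real.cos t • (S.F p : RSpace n) + Real.sin t • S.ν p

/-- The unit normal field `ν_t` of the parallel surface. -/
def parallelNormal (t : ℝ) (p : M) : RSpace n :=
  -Real.sin t • (S.F p : RSpace n) + Real.cos t • S.ν p

/-- The regular parameters: those `t` for which `F_t` has no focal point, that is, for which
`F_t` is an immersion. -/
def regularSet : Set ℝ :=
  {t | ∀ p, Function.Injective (mvfderiv (𝓡 n) (S.parallel t) p)}

/-- The metric `g_t`. -/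
def metric (t : ℝ) : MetricTensor (EuclideanSpace ℝ (Fin n)) M := inducedMetric (S.parallel t)

/-- The shape operator `A_t` of `F_t` with respect to `ν_t`. -/
def shape (t : ℝ) (p : M) : TangentSpace (𝓡 n) p →L[ℝ] TangentSpace (𝓡 n) p :=
  shapeOperator (S.parallel t) (S.parallelNormal t) p

/-- `(∇^t_X A_t) Y = ∇^t_X (A_t Y) - A_t (∇^t_X Y)` -/
def covDerivShape (t : ℝ) (X Y : (p : M) → TangentSpace (𝓡 n) p) (p : M) :
    TangentSpace (𝓡 n) p :=
  leviCivita (S.metric t) X (fun q => S.shape t q (Y q)) p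
    - S.shape t p (leviCivita (S.metric t) X Y p)

/-- `α^t(X, Y, Z) = g_t((∇^t_X A_t) Y, Z)` -/
def alpha (t : ℝ) (X Y Z : (p : M) → TangentSpace (𝓡 n) p) (p : M) : ℝ :=
  S.metric t p (S.covDerivShape t X Y p) (Z p)

/-- The lift `(F + i ν) / √2` of `F` to the Stiefel manifold, as a map into `ℂ^{n+2}`. -/
def stiefelLift (p : M) : CSpace n :=
  WithLp.toLp 2 fun i => ((Real.sqrt 2 : ℝ) : ℂ)⁻¹ *
    (((S.F p : RSpace n) i : ℂ) + Complex.I * (S.ν p i : ℂ))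

lemma stiefelLift_ne_zero (p : M) : S.stiefelLift p ≠ 0 := by
  intro h
  have hν : S.ν p = 0 := by
    ext i
    have hi : S.stiefelLift p i = 0 := by rw [h]; rfl
    have hs : ((Real.sqrt 2 : ℝ) : ℂ)⁻¹ ≠ 0 := by simp
    have := congrArg Complex.im ((mul_eq_zero.1 hi).resolve_left hs)
    simpa using this
  have := S.norm_normal p
  simp [hν] at this

lemma cBilin_stiefelLift (p : M) : cBilin (S.stiefelLift p) (S.stiefelLift p) = 0 := by
  have hF : ∑ i, (S.F p : RSpace n) i * (S.F p : RSpace n) i = 1 := by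
    have : ‖(S.F p : RSpace n)‖ = 1 := by simp
    have h2 := real_inner_self_eq_norm_sq (S.F p : RSpace n)
    rw [this, PiLp.inner_apply] at h2
    simpa [sq] using h2
  have hν : ∑ i, S.ν p i * S.ν p i = 1 := by
    have h2 := real_inner_self_eq_norm_sq (S.ν p)
    rw [S.norm_normal p, PiLp.inner_apply] at h2
    simpa [sq] using h2
  have hFν : ∑ i, (S.F p : RSpace n) i * S.ν p i = 0 := by
    have h2 := S.inner_normal p
    rw [PiLp.inner_apply] at h2
    simpa [mul_comm] using h2
  have key : cBilin (S.stiefelLift p) (S.stiefelLift p) = (((Real.sqrt 2 : ℝ) : ℂ)⁻¹) ^ 2 *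
      (((∑ i, (S.F p : RSpace n) i * (S.F p : RSpace n) i : ℝ) : ℂ)
        - ((∑ i, S.ν p i * S.ν p i : ℝ) : ℂ)
        + 2 * Complex.I * ((∑ i, (S.F p : RSpace n) i * S.ν p i : ℝ) : ℂ)) := by
    simp only [Complex.ofReal_sum, Complex.ofReal_mul, cBilin, stiefelLift, Finset.mul_sum,
      ← Finset.sum_sub_distrib, ← Finset.sum_add_distrib]
    refine Finset.sum_congr rfl fun i _ => ?_
    linear_combination ((((Real.sqrt 2 : ℝ) : ℂ)⁻¹) ^ 2 * (S.ν p i : ℂ) ^ 2) * Complex.I_sq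
  rw [key, hF, hν, hFν]
  simp

/-- The associated Lagrangian immersion `𝔏 : M → Q_n`, `p ↦ [(F(p) + i ν(p)) / √2]`. -/
def lagrangian (p : M) : Quadric n :=
  Quadric.proj ⟨S.stiefelLift p, S.stiefelLift_ne_zero p, S.cBilin_stiefelLift p⟩

/-- The metric `ĝ = 𝔏^* g_Q`. -/
def hatMetric : MetricTensor (EuclideanSpace ℝ (Fin n)) M :=
  pullbackMetric (Quadric.kahlerMetric n) S.lagrangian

/-- The normal vector field `N_X = - J d𝔏 X` along `𝔏`. -/
def normalField (X : (p : M) → TangentSpace (𝓡 n) p) (p : M) :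
    TangentSpace 𝓘(ℝ, EuclideanSpace ℂ (Fin n)) (S.lagrangian p) :=
  -(S.lagrangian p).complexStructure
    (mfderiv (𝓡 n) 𝓘(ℝ, EuclideanSpace ℂ (Fin n)) S.lagrangian p (X p))

/-- The second fundamental form `α̂(X, Y, Z) = ĝ(Â_{N_X} Y, Z)` of `𝔏`. -/
def hatAlpha (X Y Z : (p : M) → TangentSpace (𝓡 n) p) (p : M) : ℝ :=
  S.hatMetric p
    (shapeOperatorAlong (Quadric.kahlerMetric n) S.lagrangian (S.normalField X) p (Y p)) (Z p)

end IsoparametricHypersurface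

end

/-! Everything is computed in the ambient vector spaces. Let D be the directional derivative of
vector-valued functions on M, and put C(X,Y,Z) = ⟨D_X(dF Y), dν Z⟩ − ⟨D_X(dν Y), dF Z⟩. Both α^t and
2α̂ turn out to be C.

Sphere side. For a hypersurface f with unit normal ν, the Weingarten formula reads df A = −dν, and
by the Gauss formula df(∇_X Y) is the tangential part of D_X(df Y). Together they express g((∇_X
A)Y, Z) as the form C of the pair (f, ν) (`NormalPair.inducedMetric_covDeriv_shapeOperator`). This
form is alternating in the pair, and (F_t, ν_t) arises from (F, ν) by a rotation of determinant 1,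
so C is the same for every t (`NormalPair.rotate_form`).

Quadric side. Let w = (F + iν)/√2. In the affine chart centred at q the reflection u ↦ −u preserves
the metric, so the Christoffel symbols vanish at the centre and ∇^Q is there the plain derivative
(`Quadric.christoffel_kahlerMetric`). The lift w is horizontal, so passing from w to affine
coordinates creates no extra terms at the centre (`IsotropicFrame.mvfderiv_mvfderiv_coord`). Hence
α̂(X,Y,Z) = Im⟨D_Y(dw X), dw Z⟩ = ½ C(Y,X,Z) (`IsoparametricHypersurface.hatAlpha_eq`); the ½ is the
square of 1/√2.

Finally C(X,Y,Z) − C(Y,X,Z) = ⟨dF[X,Y], dν Z⟩ − ⟨dν[X,Y], dF Z⟩ = 0, because the second fundamental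
form of F is symmetric (`IsoparametricHypersurface.cubicForm_comm`). -/

noncomputable section

/-! ### First and second derivatives of maps and vector fields in a chart. -/

section ChartCalculus

variable {E : Type*} [NormedAddCommGroup E] [NormedSpace ℝ E]
  {M : Type*} [TopologicalSpace M] [ChartedSpace E M] [IsManifold 𝓘(ℝ, E) 1 M]
  {V : Type*} [NormedAddCommGroup V] [NormedSpace ℝ V]

/-- `tangentCoord` as a continuous linear map. -/
def tangentCoordL (x y : M) : TangentSpace 𝓘(ℝ, E) y →L[ℝ] E :=
  mfderiv 𝓘(ℝ, E) 𝓘(ℝ, E) (extChartAt 𝓘(ℝ, E) x) y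

lemma tangentCoord_self (x : M) (w : TangentSpace 𝓘(ℝ, E) x) :
    tangentCoord x x w = w := by
  unfold tangentCoord
  rw [mfderiv_extChartAt_self]
  rfl

lemma hasMFDerivAt_comp_extChartAt {x q : M} (hq : q ∈ (chartAt E x).source) {K : E → V}
    {K' : E →L[ℝ] V} (hK : HasFDerivAt K K' (extChartAt 𝓘(ℝ, E) x q)) {h : M → V}
    (hh : h =ᶠ[𝓝 q] fun y => K (extChartAt 𝓘(ℝ, E) x y)) :
    HasMFDerivAt 𝓘(ℝ, E) 𝓘(ℝ, V) h q (K' ∘L tangentCoordL x q) :=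
  (hK.hasMFDerivAt.comp q (mdifferentiableAt_extChartAt hq).hasMFDerivAt).congr_of_eventuallyEq hh

lemma mvfderiv_comp_extChartAt {x q : M} (hq : q ∈ (chartAt E x).source) {K : E → V}
    {K' : E →L[ℝ] V} (hK : HasFDerivAt K K' (extChartAt 𝓘(ℝ, E) x q)) {h : M → V}
    (hh : h =ᶠ[𝓝 q] fun y => K (extChartAt 𝓘(ℝ, E) x y)) (v : TangentSpace 𝓘(ℝ, E) q) :
    mvfderiv 𝓘(ℝ, E) h q v = K' (tangentCoord x q v) := by
  unfold mvfderiv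
  rw [(hasMFDerivAt_comp_extChartAt hq hK hh).mfderiv]
  rfl

omit [NormedSpace ℝ E] [IsManifold 𝓘(ℝ, E) 1 M] in
lemma eventually_mem_chartAt_source (x : M) : ∀ᶠ q in 𝓝 x, q ∈ (chartAt E x).source :=
  (chartAt E x).open_source.mem_nhds (mem_chart_source E x)

lemma mdifferentiableAt_extChartAt_symm (x : M) {u : E} (hu : u ∈ (extChartAt 𝓘(ℝ, E) x).target) :
    MDifferentiableAt 𝓘(ℝ, E) 𝓘(ℝ, E) (extChartAt 𝓘(ℝ, E) x).symm u := by
  have := mdifferentiableWithinAt_extChartAt_symm (I := 𝓘(ℝ, E)) hu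
  rwa [modelWithCornersSelf_coe, Set.range_id, mdifferentiableWithinAt_univ] at this

/-- Valid at every point of the chart domain, not only at its centre; this is what allows `df Y` to
be differentiated once more. -/
lemma mvfderiv_eq_fderiv {x q : M} (hq : q ∈ (chartAt E x).source) {h : M → V}
    (hh : MDifferentiableAt 𝓘(ℝ, E) 𝓘(ℝ, V) h q) (v : TangentSpace 𝓘(ℝ, E) q) :
    mvfderiv 𝓘(ℝ, E) h q v =
      fderiv ℝ (h ∘ (extChartAt 𝓘(ℝ, E) x).symm) (extChartAt 𝓘(ℝ, E) x q) (tangentCoord x q v) := by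
  have hq' : q ∈ (extChartAt 𝓘(ℝ, E) x).source := by simpa using hq
  have hs := mdifferentiableAt_extChartAt_symm x ((extChartAt 𝓘(ℝ, E) x).map_source hq')
  have hd : DifferentiableAt ℝ (h ∘ (extChartAt 𝓘(ℝ, E) x).symm) (extChartAt 𝓘(ℝ, E) x q) := by
    rw [← mdifferentiableAt_iff_differentiableAt]
    refine MDifferentiableAt.comp (I' := 𝓘(ℝ, E)) _ ?_ hs
    rwa [(extChartAt 𝓘(ℝ, E) x).left_inv hq']
  refine mvfderiv_comp_extChartAt hq hd.hasFDerivAt ?_ v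
  filter_upwards [(chartAt E x).open_source.mem_nhds hq] with y hy
  simp only [Function.comp]
  rw [(extChartAt 𝓘(ℝ, E) x).left_inv (by simpa using hy)]

lemma mvfderiv_extChartAt_symm (x : M) {u : E} (hu : u ∈ (extChartAt 𝓘(ℝ, E) x).target)
    {h : M → V} (hh : MDifferentiableAt 𝓘(ℝ, E) 𝓘(ℝ, V) h ((extChartAt 𝓘(ℝ, E) x).symm u)) (a : E) :
    mvfderiv 𝓘(ℝ, E) h ((extChartAt 𝓘(ℝ, E) x).symm u)
      (mfderiv 𝓘(ℝ, E) 𝓘(ℝ, E) (extChartAt 𝓘(ℝ, E) x).symm u a) =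
      fderiv ℝ (h ∘ (extChartAt 𝓘(ℝ, E) x).symm) u a := by
  rw [← mfderiv_eq_fderiv, mfderiv_comp u hh (mdifferentiableAt_extChartAt_symm x hu)]
  rfl

omit [IsManifold 𝓘(ℝ, E) 1 M] in
lemma contDiffAt_comp_extChartAt_symm {m : ℕ∞ω} (x : M) {h : M → V}
    (hh : ContMDiffAt 𝓘(ℝ, E) 𝓘(ℝ, V) m h x) :
    ContDiffAt ℝ m (h ∘ (extChartAt 𝓘(ℝ, E) x).symm) (extChartAt 𝓘(ℝ, E) x x) := by
  have := (contMDiffAt_iff.1 hh).2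
  rwa [modelWithCornersSelf_coe, Set.range_id, contDiffWithinAt_univ] at this


/-- The coordinates of a vector field, as a function on the manifold. -/
def fieldCoord (x : M) (Y : (q : M) → TangentSpace 𝓘(ℝ, E) q) (q : M) : E := tangentCoord x q (Y q)

/-- The derivative at `p` of a vector field in the chart centred at `p`. -/
def fieldDeriv (Y : (q : M) → TangentSpace 𝓘(ℝ, E) q) (p : M) (v : TangentSpace 𝓘(ℝ, E) p) :
    TangentSpace 𝓘(ℝ, E) p :=
  (mvfderiv 𝓘(ℝ, E) (fieldCoord p Y) p v : E)

/-- The derivative at `p` in the chart centred at `p`. -/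
def chartDeriv (h : M → V) (p : M) : E →L[ℝ] V := mvfderiv 𝓘(ℝ, E) h p

/-- The second derivative at `p` in the chart centred at `p`. -/
def chartHess (h : M → V) (p : M) (v w : TangentSpace 𝓘(ℝ, E) p) : V :=
  fderiv ℝ (fderiv ℝ (h ∘ (extChartAt 𝓘(ℝ, E) p).symm)) (extChartAt 𝓘(ℝ, E) p p) v w

/-- The Christoffel symbols, as a bilinear operation on tangent vectors at `p`. -/
def christoffelAt (g : MetricTensor E M) (p : M) (v w : TangentSpace 𝓘(ℝ, E) p) :
    TangentSpace 𝓘(ℝ, E) p :=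
  (christoffel (N := M) (F := E) g p v w : E)

/-- The chart centred at p has the identity as its derivative at p, so the changes of coordinates in
`covDerivAlong` disappear. -/
lemma leviCivita_eq (g : MetricTensor E M) (X Y : (q : M) → TangentSpace 𝓘(ℝ, E) q) (p : M) :
    leviCivita g X Y p = fieldDeriv Y p (X p) + christoffelAt g p (X p) (Y p) := by
  unfold leviCivita covDerivAlong
  have h1 : mfderiv 𝓘(ℝ, E) 𝓘(ℝ, E) (fun q : M => q) p = ContinuousLinearMap.id ℝ _ := mfderiv_id
  simp only [h1, tangentCoord_self, mfderiv_extChartAt_self]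
  erw [ContinuousLinearMap.inverse_id]
  simp only [ContinuousLinearMap.id_apply]
  rfl

lemma eventually_mvfderiv_apply_eq (p : M) {f : M → V}
    (hf : ContMDiff 𝓘(ℝ, E) 𝓘(ℝ, V) 2 f) (Y : (q : M) → TangentSpace 𝓘(ℝ, E) q) :
    (fun q => mvfderiv 𝓘(ℝ, E) f q (Y q)) =ᶠ[𝓝 p] fun q : M =>
      (fun u => fderiv ℝ (f ∘ (extChartAt 𝓘(ℝ, E) p).symm) u
        (fieldCoord p Y ((extChartAt 𝓘(ℝ, E) p).symm u))) (extChartAt 𝓘(ℝ, E) p q) := by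
  filter_upwards [eventually_mem_chartAt_source (E := E) p] with q hq
  rw [mvfderiv_eq_fderiv hq (hf.mdifferentiableAt two_ne_zero)]
  rw [(extChartAt 𝓘(ℝ, E) p).left_inv (by simpa using hq)]
  rfl

lemma hasFDerivAt_comp_extChartAt_symm (p : M) {h : M → V}
    (hh : MDifferentiableAt 𝓘(ℝ, E) 𝓘(ℝ, V) h p) :
    HasFDerivAt (h ∘ (extChartAt 𝓘(ℝ, E) p).symm) (chartDeriv h p)
      (extChartAt 𝓘(ℝ, E) p p) := by
  have hd : DifferentiableAt ℝ (h ∘ (extChartAt 𝓘(ℝ, E) p).symm) (extChartAt 𝓘(ℝ, E) p p) := by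
    rw [← mdifferentiableAt_iff_differentiableAt]
    refine MDifferentiableAt.comp (I' := 𝓘(ℝ, E)) _ ?_
      (mdifferentiableAt_extChartAt_symm p (mem_extChartAt_target p))
    rwa [(extChartAt 𝓘(ℝ, E) p).left_inv (mem_extChartAt_source p)]
  have : chartDeriv h p = fderiv ℝ (h ∘ (extChartAt 𝓘(ℝ, E) p).symm) (extChartAt 𝓘(ℝ, E) p p) := by
    ext v
    exact (mvfderiv_eq_fderiv (mem_chart_source E p) hh v).trans
      (congrArg _ (tangentCoord_self p v))
  rw [this]
  exact hd.hasFDerivAt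

lemma hasFDerivAt_fderiv_apply_fieldCoord (p : M) {f : M → V}
    (hf : ContMDiff 𝓘(ℝ, E) 𝓘(ℝ, V) 2 f) {Y : (q : M) → TangentSpace 𝓘(ℝ, E) q}
    (hY : MDifferentiableAt 𝓘(ℝ, E) 𝓘(ℝ, E) (fieldCoord p Y) p) :
    HasFDerivAt (fun u => fderiv ℝ (f ∘ (extChartAt 𝓘(ℝ, E) p).symm) u
        (fieldCoord p Y ((extChartAt 𝓘(ℝ, E) p).symm u)))
      (chartDeriv f p ∘L chartDeriv (fieldCoord p Y) p +
        (fderiv ℝ (fderiv ℝ (f ∘ (extChartAt 𝓘(ℝ, E) p).symm)) (extChartAt 𝓘(ℝ, E) p p)).flip (Y p))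
      (extChartAt 𝓘(ℝ, E) p p) := by
  have h1 : DifferentiableAt ℝ (fderiv ℝ (f ∘ (extChartAt 𝓘(ℝ, E) p).symm))
      (extChartAt 𝓘(ℝ, E) p p) :=
    ((contDiffAt_comp_extChartAt_symm p hf.contMDiffAt).fderiv_right (m := 1)
      (by norm_num [one_add_one_eq_two])).differentiableAt one_ne_zero
  have h2 := h1.hasFDerivAt.clm_apply (hasFDerivAt_comp_extChartAt_symm p hY)
  have h3 : (fieldCoord p Y ∘ (extChartAt 𝓘(ℝ, E) p).symm) (extChartAt 𝓘(ℝ, E) p p) = Y p := by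
    rw [Function.comp_apply, extChartAt_to_inv, fieldCoord, tangentCoord_self]
  rwa [(hasFDerivAt_comp_extChartAt_symm p (hf.mdifferentiableAt two_ne_zero)).fderiv, h3] at h2

lemma mdifferentiableAt_mvfderiv_apply (p : M) {f : M → V}
    (hf : ContMDiff 𝓘(ℝ, E) 𝓘(ℝ, V) 2 f) {Y : (q : M) → TangentSpace 𝓘(ℝ, E) q}
    (hY : MDifferentiableAt 𝓘(ℝ, E) 𝓘(ℝ, E) (fieldCoord p Y) p) :
    MDifferentiableAt 𝓘(ℝ, E) 𝓘(ℝ, V) (fun q => mvfderiv 𝓘(ℝ, E) f q (Y q)) p :=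
  (hasMFDerivAt_comp_extChartAt (mem_chart_source E p)
    (hasFDerivAt_fderiv_apply_fieldCoord p hf hY)
    (eventually_mvfderiv_apply_eq p hf Y)).mdifferentiableAt

/-- Product rule for Df(q)·Y(q). Each summand depends on the chart; only the second one, which is
symmetric, involves second derivatives of f. -/
lemma mvfderiv_mvfderiv_apply (p : M) {f : M → V}
    (hf : ContMDiff 𝓘(ℝ, E) 𝓘(ℝ, V) 2 f) {Y : (q : M) → TangentSpace 𝓘(ℝ, E) q}
    (hY : MDifferentiableAt 𝓘(ℝ, E) 𝓘(ℝ, E) (fieldCoord p Y) p) (v : TangentSpace 𝓘(ℝ, E) p) :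
    mvfderiv 𝓘(ℝ, E) (fun q => mvfderiv 𝓘(ℝ, E) f q (Y q)) p v =
      mvfderiv 𝓘(ℝ, E) f p (fieldDeriv Y p v) + chartHess f p v (Y p) := by
  rw [mvfderiv_comp_extChartAt (mem_chart_source E p)
    (hasFDerivAt_fderiv_apply_fieldCoord p hf hY) (eventually_mvfderiv_apply_eq p hf Y),
    tangentCoord_self]
  rfl

omit [IsManifold 𝓘(ℝ, E) 1 M] in
lemma chartHess_comm (p : M) {f : M → V}
    (hf : ContMDiff 𝓘(ℝ, E) 𝓘(ℝ, V) 2 f) (a b : TangentSpace 𝓘(ℝ, E) p) :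
    chartHess f p a b = chartHess f p b a :=
  (contDiffAt_comp_extChartAt_symm p hf.contMDiffAt).isSymmSndFDerivAt (by simp) a b

/-- The derivatives of `df Y` along `X` and of `df X` along `Y` differ by the derivative of `f`
along the bracket of `X` and `Y`. -/
lemma mvfderiv_mvfderiv_comm (p : M) {f : M → V}
    (hf : ContMDiff 𝓘(ℝ, E) 𝓘(ℝ, V) 2 f) {X Y : (q : M) → TangentSpace 𝓘(ℝ, E) q}
    (hX : MDifferentiableAt 𝓘(ℝ, E) 𝓘(ℝ, E) (fieldCoord p X) p)
    (hY : MDifferentiableAt 𝓘(ℝ, E) 𝓘(ℝ, E) (fieldCoord p Y) p) :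
    mvfderiv 𝓘(ℝ, E) (fun q => mvfderiv 𝓘(ℝ, E) f q (Y q)) p (X p) =
      mvfderiv 𝓘(ℝ, E) (fun q => mvfderiv 𝓘(ℝ, E) f q (X q)) p (Y p) +
      mvfderiv 𝓘(ℝ, E) f p (fieldDeriv Y p (X p) - fieldDeriv X p (Y p)) := by
  rw [mvfderiv_mvfderiv_apply p hf hX, mvfderiv_mvfderiv_apply p hf hY, chartHess_comm p hf,
    map_sub]
  abel

lemma mdifferentiableAt_fieldCoord [IsManifold 𝓘(ℝ, E) ∞ M]
    (Y : ContMDiffSection 𝓘(ℝ, E) E ∞ (TangentSpace 𝓘(ℝ, E) : M → Type _)) (p : M) :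
    MDifferentiableAt 𝓘(ℝ, E) 𝓘(ℝ, E) (fieldCoord p Y) p := by
  have h := ((Bundle.contMDiffAt_totalSpace).1 (Y.contMDiff p)).2
  refine (h.mdifferentiableAt (by simp)).congr_of_eventuallyEq ?_
  -- Over the chart domain, the preferred trivialization of the tangent bundle at p reads off the
  -- same coordinates as `fieldCoord p`.
  filter_upwards [eventually_mem_chartAt_source (E := E) p] with q hq
  have := TangentBundle.continuousLinearMapAt_trivializationAt (I := 𝓘(ℝ, E)) hq
  exact (DFunLike.congr_fun this (Y q)).symm.trans
    (Bundle.Trivialization.continuousLinearMapAt_apply_of_mem (R := ℝ)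
      (trivializationAt E (TangentSpace 𝓘(ℝ, E)) p) (by simpa using hq) _)

-- If L is a left inverse of T p, then L ∘ T q stays invertible for q near p, and w = (L T)⁻¹ L (T
-- w). With T the derivative of f and w = A Y, the regularity of A Y follows from that of dν Y,
-- without differentiating the shape operator.
omit [IsManifold 𝓘(ℝ, E) 1 M] in
lemma mdifferentiableAt_of_clm_apply {W : Type*} [NormedAddCommGroup W] [NormedSpace ℝ W]
    [FiniteDimensional ℝ W] [FiniteDimensional ℝ V] {p : M}
    {T : M → W →L[ℝ] V} (hT : MDifferentiableAt 𝓘(ℝ, E) 𝓘(ℝ, W →L[ℝ] V) T p)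
    (hinj : Function.Injective (T p)) {w : M → W}
    (hw : MDifferentiableAt 𝓘(ℝ, E) 𝓘(ℝ, V) (fun q => T q (w q)) p) :
    MDifferentiableAt 𝓘(ℝ, E) 𝓘(ℝ, W) w p := by
  obtain ⟨L₀, hL₀⟩ := LinearMap.exists_leftInverse_of_injective (T p : W →ₗ[ℝ] V)
    (LinearMap.ker_eq_bot.2 hinj)
  let L : V →L[ℝ] W := L₀.toContinuousLinearMap
  have hLT : L ∘L T p = ContinuousLinearMap.id ℝ W := by
    ext x; exact congrArg (fun f => f x) hL₀
  let K : M → W →L[ℝ] W := fun q => L ∘L T q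
  have hK : MDifferentiableAt 𝓘(ℝ, E) 𝓘(ℝ, W →L[ℝ] W) K p :=
    ((ContinuousLinearMap.compL ℝ W V W L).differentiableAt.mdifferentiableAt).comp p hT
  have hinv : MDifferentiableAt 𝓘(ℝ, E) 𝓘(ℝ, W →L[ℝ] W) (fun q => (K q).inverse) p := by
    have h1 : ContDiffAt ℝ 1 (ContinuousLinearMap.inverse : (W →L[ℝ] W) → (W →L[ℝ] W)) (K p) := by
      refine ContinuousLinearMap.IsInvertible.contDiffAt_map_inverse ?_
      simp only [K, hLT]
      exact ⟨ContinuousLinearEquiv.refl ℝ W, rfl⟩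
    exact (h1.differentiableAt one_ne_zero).mdifferentiableAt.comp p hK
  have hev : ∀ᶠ q in 𝓝 p, (K q).IsInvertible := by
    have hopen : IsOpen (Set.range ((↑) : (W ≃L[ℝ] W) → W →L[ℝ] W)) :=
      ContinuousLinearEquiv.isOpen
    refine hK.continuousAt.eventually (hopen.mem_nhds ?_)
    simp only [K, hLT]
    exact ⟨ContinuousLinearEquiv.refl ℝ W, rfl⟩
  have hLw : MDifferentiableAt 𝓘(ℝ, E) 𝓘(ℝ, W) (fun q => L (T q (w q))) p :=
    L.differentiableAt.mdifferentiableAt.comp p hw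
  refine (hinv.clm_apply hLw).congr_of_eventuallyEq ?_
  filter_upwards [hev] with q hq
  exact (hq.inverse_apply_self (w q)).symm

end ChartCalculus

/-! ### Pulled-back inner products and the Koszul formula. -/

section InnerMetric

variable {E : Type*} [NormedAddCommGroup E] [NormedSpace ℝ E]
  {V : Type*} [NormedAddCommGroup V] [InnerProductSpace ℝ V]

/-- Christoffel symbols and shape operators are defined through `inverse`, which is zero off the
invertible maps; this is the criterion that makes them meaningful. -/
lemma isInvertible_of_nondegenerate [FiniteDimensional ℝ E] (B : E →L[ℝ] E →L[ℝ] ℝ)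
    (hB : ∀ v, B v v = 0 → v = 0) : B.IsInvertible := by
  have hinj : Function.Injective (B : E →ₗ[ℝ] E →L[ℝ] ℝ) := by
    rw [← LinearMap.ker_eq_bot, LinearMap.ker_eq_bot']
    intro v hv
    refine hB v ?_
    have : B v = 0 := hv
    rw [this]; rfl
  have hdim : Module.finrank ℝ E = Module.finrank ℝ (E →L[ℝ] ℝ) := by
    rw [← (LinearMap.toContinuousLinearMap (𝕜 := ℝ) (E := E) (F' := ℝ)).finrank_eq]
    exact Subspace.dual_finrank_eq.symm
  exact ⟨(LinearEquiv.ofInjectiveOfFinrankEq (B : E →ₗ[ℝ] E →L[ℝ] ℝ) hinj hdim).toContinuousLinearEquiv,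
    by ext; rfl⟩

/-- The bilinear form `⟨T v, T w⟩`. -/
def pullInner (T : E →L[ℝ] V) : E →L[ℝ] E →L[ℝ] ℝ :=
  (ContinuousLinearMap.compL ℝ E V ℝ).flip T ∘L innerSL ℝ ∘L T

lemma pullInner_apply (T : E →L[ℝ] V) (v w : E) : pullInner T v w = inner ℝ (T v) (T w) := rfl

lemma isInvertible_pullInner [FiniteDimensional ℝ E] (T : E →L[ℝ] V)
    (hT : Function.Injective T) : (pullInner T).IsInvertible :=
  isInvertible_of_nondegenerate _ fun v hv => by
    rw [pullInner_apply, inner_self_eq_zero] at hv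
    exact hT (hv.trans (map_zero T).symm)

lemma hasFDerivAt_pullInner_apply {T : E → E →L[ℝ] V} {T' : E →L[ℝ] E →L[ℝ] V} {u : E}
    (hT : HasFDerivAt T T' u) (a b c : E) :
    fderiv ℝ (fun u => pullInner (T u)) u a b c =
      inner ℝ (T' a b) (T u c) + inner ℝ (T u b) (T' a c) := by
  have hd : DifferentiableAt ℝ (fun u => pullInner (T u)) u := by
    unfold pullInner
    have h1 := hT.differentiableAt
    fun_prop
  have h2 : HasFDerivAt (fun u => inner ℝ (T u b) (T u c)) _ u :=
    (hT.clm_apply (hasFDerivAt_const b u)).inner ℝ (hT.clm_apply (hasFDerivAt_const c u))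
  have h3 : HasFDerivAt (fun u => pullInner (T u) b c) _ u :=
    (hd.hasFDerivAt.clm_apply (hasFDerivAt_const b u)).clm_apply (hasFDerivAt_const c u)
  have h4 := congrArg (fun L => L a) (h3.unique h2)
  simpa [add_comm, real_inner_comm] using h4

variable {M : Type*} [TopologicalSpace M] [ChartedSpace E M]

lemma metricInChart_christoffel (g : MetricTensor E M) (x : M)
    (hg : (metricInChart g x (extChartAt 𝓘(ℝ, E) x x)).IsInvertible) (a b c : E) :
    metricInChart g x (extChartAt 𝓘(ℝ, E) x x) (christoffel g x a b) c =
      (1 / 2 : ℝ) * (fderiv ℝ (metricInChart g x) (extChartAt 𝓘(ℝ, E) x x) a b c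
        + fderiv ℝ (metricInChart g x) (extChartAt 𝓘(ℝ, E) x x) b a c
        - fderiv ℝ (metricInChart g x) (extChartAt 𝓘(ℝ, E) x x) c a b) := by
  unfold christoffel
  simp only [hg.self_apply_inverse]
  simp

end InnerMetric

/-! ### The Gauss formula for the induced metric. -/

section Induced

variable {n : ℕ} {M : Type*} [TopologicalSpace M] [ChartedSpace (EuclideanSpace ℝ (Fin n)) M]
  [IsManifold (𝓡 n) ∞ M]

omit [IsManifold (𝓡 n) ∞ M] in
lemma inducedMetric_apply (f : M → RSpace n) (p : M) (v w : TangentSpace (𝓡 n) p) :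
    inducedMetric f p v w = inner ℝ (mvfderiv (𝓡 n) f p v) (mvfderiv (𝓡 n) f p w) := rfl

omit [IsManifold (𝓡 n) ∞ M] in
lemma inducedMetric_isInvertible {f : M → RSpace n} {p : M}
    (hf : Function.Injective (mvfderiv (𝓡 n) f p)) : (inducedMetric f p).IsInvertible :=
  isInvertible_pullInner (E := EuclideanSpace ℝ (Fin n)) (mvfderiv (𝓡 n) f p) hf

lemma metricInChart_inducedMetric {f : M → RSpace n} (hf : ContMDiff (𝓡 n) 𝓘(ℝ, RSpace n) 2 f)
    (p : M) : metricInChart (inducedMetric f) p =ᶠ[𝓝 (extChartAt (𝓡 n) p p)] fun u =>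
      pullInner (fderiv ℝ (f ∘ (extChartAt (𝓡 n) p).symm) u) := by
  filter_upwards [extChartAt_target_mem_nhds p] with u hu
  ext a b
  rw [pullInner_apply, ← mvfderiv_extChartAt_symm p hu (hf.mdifferentiableAt two_ne_zero),
    ← mvfderiv_extChartAt_symm p hu (hf.mdifferentiableAt two_ne_zero)]
  rfl

/-- The Gauss formula. -/
lemma inner_mvfderiv_leviCivita {f : M → RSpace n} (hf : ContMDiff (𝓡 n) 𝓘(ℝ, RSpace n) 2 f)
    {p : M} (hinj : Function.Injective (mvfderiv (𝓡 n) f p))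
    (X : (q : M) → TangentSpace (𝓡 n) q) {Y : (q : M) → TangentSpace (𝓡 n) q}
    (hY : MDifferentiableAt (𝓡 n) (𝓡 n) (fieldCoord p Y) p) (z : TangentSpace (𝓡 n) p) :
    inner ℝ (mvfderiv (𝓡 n) f p (leviCivita (inducedMetric f) X Y p)) (mvfderiv (𝓡 n) f p z) =
      inner ℝ (mvfderiv (𝓡 n) (fun q => mvfderiv (𝓡 n) f q (Y q)) p (X p))
        (mvfderiv (𝓡 n) f p z) := by
  rw [mvfderiv_mvfderiv_apply p hf hY, leviCivita_eq, map_add, inner_add_left, inner_add_left]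
  -- The term df(∂_X Y) is common to both sides; what remains compares df(Γ(X, Y)) with the Hessian
  -- of f, both paired with df z.
  congr 1
  let u := extChartAt (𝓡 n) p p
  let T := fderiv ℝ (f ∘ (extChartAt (𝓡 n) p).symm)
  have hm := metricInChart_inducedMetric hf p
  have hTu : T u = chartDeriv f p :=
    (hasFDerivAt_comp_extChartAt_symm p (hf.mdifferentiableAt two_ne_zero)).fderiv
  have hT : HasFDerivAt T (fderiv ℝ T u) u :=
    (((contDiffAt_comp_extChartAt_symm p hf.contMDiffAt).fderiv_right (m := 1)
      (by norm_num [one_add_one_eq_two])).differentiableAt one_ne_zero).hasFDerivAt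
  have hinv : (metricInChart (inducedMetric f) p u).IsInvertible := by
    rw [hm.eq_of_nhds]
    refine isInvertible_pullInner _ ?_
    rw [show fderiv ℝ (f ∘ (extChartAt (𝓡 n) p).symm) u = chartDeriv f p from hTu]
    exact hinj
  have hm' : metricInChart (inducedMetric f) p =ᶠ[𝓝 u] fun u => pullInner (T u) := hm
  have hsymm (a b : EuclideanSpace ℝ (Fin n)) : fderiv ℝ T u a b = fderiv ℝ T u b a :=
    chartHess_comm p hf a b
  have key (a b c : EuclideanSpace ℝ (Fin n)) :
      inner ℝ (chartDeriv f p (christoffel (inducedMetric f) p a b)) (chartDeriv f p c) =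
        inner ℝ (fderiv ℝ T u a b) (chartDeriv f p c) := by
    -- By symmetry of the Hessian T', four of the six terms of the Koszul combination cancel and the
    -- other two give 2⟨T' a b, T c⟩.
    have h := metricInChart_christoffel (inducedMetric f) p hinv a b c
    rw [hm'.fderiv_eq, hm'.eq_of_nhds, pullInner_apply, hasFDerivAt_pullInner_apply hT,
      hasFDerivAt_pullInner_apply hT, hasFDerivAt_pullInner_apply hT, hsymm b a, hsymm c a,
      hsymm c b, hTu, real_inner_comm (chartDeriv f p b)] at h
    rw [h]
    ring
  exact key (X p) (Y p) z

end Induced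

/-! ### Product rules on a manifold. -/

section Bilin

variable {E : Type*} [NormedAddCommGroup E] [NormedSpace ℝ E]
  {M : Type*} [TopologicalSpace M] [ChartedSpace E M] [IsManifold 𝓘(ℝ, E) 1 M]
  {V W G : Type*} [NormedAddCommGroup V] [NormedSpace ℝ V] [NormedAddCommGroup W] [NormedSpace ℝ W]
  [NormedAddCommGroup G] [NormedSpace ℝ G]

lemma hasFDerivAt_bilin_comp_extChartAt_symm (B : V →L[ℝ] W →L[ℝ] G) {f : M → V} {h : M → W} {p : M}
    (hf : MDifferentiableAt 𝓘(ℝ, E) 𝓘(ℝ, V) f p) (hh : MDifferentiableAt 𝓘(ℝ, E) 𝓘(ℝ, W) h p) :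
    HasFDerivAt (fun u => B (f ((extChartAt 𝓘(ℝ, E) p).symm u)) (h ((extChartAt 𝓘(ℝ, E) p).symm u)))
      (B (f p) ∘L chartDeriv h p + (B.flip (h p)) ∘L chartDeriv f p) (extChartAt 𝓘(ℝ, E) p p) := by
  have h1 := (B.hasFDerivAt.comp _ (hasFDerivAt_comp_extChartAt_symm p hf)).clm_apply
    (hasFDerivAt_comp_extChartAt_symm p hh)
  simp only [Function.comp, extChartAt_to_inv] at h1
  exact h1

lemma mvfderiv_bilin (B : V →L[ℝ] W →L[ℝ] G) {f : M → V} {h : M → W} {p : M}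
    (hf : MDifferentiableAt 𝓘(ℝ, E) 𝓘(ℝ, V) f p) (hh : MDifferentiableAt 𝓘(ℝ, E) 𝓘(ℝ, W) h p)
    (v : TangentSpace 𝓘(ℝ, E) p) :
    mvfderiv 𝓘(ℝ, E) (fun q => B (f q) (h q)) p v =
      B (f p) (mvfderiv 𝓘(ℝ, E) h p v) + B (mvfderiv 𝓘(ℝ, E) f p v) (h p) := by
  rw [mvfderiv_comp_extChartAt (mem_chart_source E p)
    (hasFDerivAt_bilin_comp_extChartAt_symm B hf hh), tangentCoord_self]
  · rfl
  · filter_upwards [eventually_mem_chartAt_source (E := E) p] with q hq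
    rw [(extChartAt 𝓘(ℝ, E) p).left_inv (by simpa using hq)]

omit [IsManifold 𝓘(ℝ, E) 1 M] in
lemma mvfderiv_congr {f h : M → V} {p : M} (hfh : f =ᶠ[𝓝 p] h) :
    mvfderiv 𝓘(ℝ, E) f p = mvfderiv 𝓘(ℝ, E) h p := by
  ext v
  unfold mvfderiv
  rw [hfh.mfderiv_eq]
  rfl

lemma mvfderiv_clm_comp (L : V →L[ℝ] W) {f : M → V} {p : M}
    (hf : MDifferentiableAt 𝓘(ℝ, E) 𝓘(ℝ, V) f p) (v : TangentSpace 𝓘(ℝ, E) p) :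
    mvfderiv 𝓘(ℝ, E) (fun q => L (f q)) p v = L (mvfderiv 𝓘(ℝ, E) f p v) := by
  rw [mvfderiv_comp_extChartAt (mem_chart_source E p)
    (L.hasFDerivAt.comp _ (hasFDerivAt_comp_extChartAt_symm p hf)), tangentCoord_self]
  · rfl
  · filter_upwards [eventually_mem_chartAt_source (E := E) p] with q hq
    simp only [Function.comp]
    rw [(extChartAt 𝓘(ℝ, E) p).left_inv (by simpa using hq)]

lemma mvfderiv_inner {V : Type*} [NormedAddCommGroup V] [InnerProductSpace ℝ V] {f h : M → V} {p : M}
    (hf : MDifferentiableAt 𝓘(ℝ, E) 𝓘(ℝ, V) f p) (hh : MDifferentiableAt 𝓘(ℝ, E) 𝓘(ℝ, V) h p)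
    (v : TangentSpace 𝓘(ℝ, E) p) :
    mvfderiv 𝓘(ℝ, E) (fun q => (inner ℝ (f q) (h q) : ℝ)) p v =
      inner ℝ (f p) (mvfderiv 𝓘(ℝ, E) h p v) + inner ℝ (mvfderiv 𝓘(ℝ, E) f p v) (h p) :=
  mvfderiv_bilin (innerSL ℝ) hf hh v

end Bilin

/-! ### Hypersurfaces of the sphere: second fundamental form and Weingarten formula. -/

section Hypersurface

variable {n : ℕ} {M : Type*} [TopologicalSpace M] [ChartedSpace (EuclideanSpace ℝ (Fin n)) M]

/-- A map to the sphere `S^{n+1}` together with a unit normal field. -/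
structure NormalPair (f ν : M → RSpace n) : Prop where
  smooth : ContMDiff (𝓡 n) 𝓘(ℝ, RSpace n) 2 f
  smooth_normal : ContMDiff (𝓡 n) 𝓘(ℝ, RSpace n) 2 ν
  inner_self : ∀ p, inner ℝ (f p) (f p) = (1 : ℝ)
  inner_normal_self : ∀ p, inner ℝ (ν p) (ν p) = (1 : ℝ)
  inner_normal : ∀ p, inner ℝ (f p) (ν p) = (0 : ℝ)
  normal : ∀ p v, inner ℝ (mvfderiv (𝓡 n) f p v) (ν p) = (0 : ℝ)

namespace NormalPair

variable {f ν : M → RSpace n} (H : NormalPair f ν)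
include H

lemma mdiff (p : M) : MDifferentiableAt (𝓡 n) 𝓘(ℝ, RSpace n) f p :=
  H.smooth.mdifferentiableAt two_ne_zero

lemma mdiff_normal (p : M) : MDifferentiableAt (𝓡 n) 𝓘(ℝ, RSpace n) ν p :=
  H.smooth_normal.mdifferentiableAt two_ne_zero

variable [IsManifold (𝓡 n) ∞ M]

lemma inner_deriv_self (p : M) (v : TangentSpace (𝓡 n) p) :
    inner ℝ (f p) (mvfderiv (𝓡 n) f p v) = (0 : ℝ) := by
  have h := mvfderiv_inner (H.mdiff p) (H.mdiff p) v
  rw [show (fun q => (inner ℝ (f q) (f q) : ℝ)) = fun _ => 1 from funext H.inner_self,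
    mvfderiv_const, real_inner_comm (f p)] at h
  have h' : (0 : ℝ) = inner ℝ (f p) (mvfderiv (𝓡 n) f p v) + inner ℝ (f p) (mvfderiv (𝓡 n) f p v) :=
    h
  linarith

lemma inner_normal_deriv_normal (p : M) (v : TangentSpace (𝓡 n) p) :
    inner ℝ (ν p) (mvfderiv (𝓡 n) ν p v) = (0 : ℝ) := by
  have h := mvfderiv_inner (H.mdiff_normal p) (H.mdiff_normal p) v
  rw [show (fun q => (inner ℝ (ν q) (ν q) : ℝ)) = fun _ => 1 from funext H.inner_normal_self,
    mvfderiv_const, real_inner_comm (ν p)] at h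
  have h' : (0 : ℝ) = inner ℝ (ν p) (mvfderiv (𝓡 n) ν p v) + inner ℝ (ν p) (mvfderiv (𝓡 n) ν p v) :=
    h
  linarith

lemma inner_deriv_normal (p : M) (v : TangentSpace (𝓡 n) p) :
    inner ℝ (f p) (mvfderiv (𝓡 n) ν p v) = (0 : ℝ) := by
  have h := mvfderiv_inner (H.mdiff p) (H.mdiff_normal p) v
  rw [show (fun q => (inner ℝ (f q) (ν q) : ℝ)) = fun _ => 0 from funext H.inner_normal,
    mvfderiv_const, H.normal, add_zero] at h
  exact h.symm

/-- The second fundamental form is symmetric. -/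
lemma inner_deriv_comm (p : M) (v w : TangentSpace (𝓡 n) p) :
    inner ℝ (mvfderiv (𝓡 n) ν p v) (mvfderiv (𝓡 n) f p w) =
      (inner ℝ (mvfderiv (𝓡 n) ν p w) (mvfderiv (𝓡 n) f p v) : ℝ) := by
  -- Differentiate ⟨∂_w f, ν⟩ = 0 along v. The Hessian term is symmetric in v and w, hence so is the
  -- other.
  have key (v w : EuclideanSpace ℝ (Fin n)) : inner ℝ (chartHess f p v w) (ν p) +
      (inner ℝ (chartDeriv ν p v) (chartDeriv f p w) : ℝ) = 0 := by
    have hT : HasFDerivAt (fderiv ℝ (f ∘ (extChartAt (𝓡 n) p).symm)) _ (extChartAt (𝓡 n) p p) :=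
      (((contDiffAt_comp_extChartAt_symm p H.smooth.contMDiffAt).fderiv_right (m := 1)
        (by norm_num [one_add_one_eq_two])).differentiableAt one_ne_zero).hasFDerivAt
    have h1 := (hT.clm_apply (hasFDerivAt_const w _)).inner ℝ
      (hasFDerivAt_comp_extChartAt_symm p (H.mdiff_normal p))
    have h0 : (fun u => (inner ℝ (fderiv ℝ (f ∘ (extChartAt (𝓡 n) p).symm) u w)
        ((ν ∘ (extChartAt (𝓡 n) p).symm) u) : ℝ)) =ᶠ[𝓝 (extChartAt (𝓡 n) p p)] fun _ => 0 := by
      filter_upwards [extChartAt_target_mem_nhds p] with u hu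
      rw [← mvfderiv_extChartAt_symm p hu (H.mdiff _)]
      exact H.normal _ _
    have h2 := congrArg (fun L => L v) (h1.unique ((hasFDerivAt_const 0 _).congr_of_eventuallyEq h0))
    simp only [(hasFDerivAt_comp_extChartAt_symm p (H.mdiff p)).fderiv, Function.comp_apply,
      extChartAt_to_inv, ContinuousLinearMap.comp_apply, ContinuousLinearMap.prod_apply,
      fderivInnerCLM_apply, add_apply, zero_apply,
      map_zero, zero_add, ContinuousLinearMap.flip_apply] at h2
    rw [add_comm, real_inner_comm]
    exact h2
  have h1 := key v w
  have h2 := key w v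
  rw [chartHess_comm p H.smooth] at h1
  exact add_left_cancel (h1.trans h2.symm)

/-- The Weingarten formula. -/
lemma mvfderiv_shapeOperator {p : M} (hinj : Function.Injective (mvfderiv (𝓡 n) f p))
    (v : TangentSpace (𝓡 n) p) :
    mvfderiv (𝓡 n) f p (shapeOperator f ν p v) = -mvfderiv (𝓡 n) ν p v := by
  set A := shapeOperator f ν p v with hA
  -- The defect x is orthogonal to f, to ν and to the image of df.
  set x := mvfderiv (𝓡 n) f p A + mvfderiv (𝓡 n) ν p v with hx
  have hxf : inner ℝ (f p) x = (0 : ℝ) := by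
    rw [hx, inner_add_right, H.inner_deriv_self, H.inner_deriv_normal, add_zero]
  have hxν : inner ℝ (ν p) x = (0 : ℝ) := by
    rw [hx, inner_add_right, H.inner_normal_deriv_normal, real_inner_comm, H.normal, add_zero]
  have hxd (w : TangentSpace (𝓡 n) p) : inner ℝ x (mvfderiv (𝓡 n) f p w) = (0 : ℝ) := by
    have h : inducedMetric f p A = -(ContinuousLinearMap.precomp ℝ (mvfderiv (𝓡 n) f p) ∘L
        innerSL ℝ ∘L mvfderiv (𝓡 n) ν p) v :=
      (inducedMetric_isInvertible hinj).self_apply_inverse _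
    have h' := congrArg (fun L => L w) h
    have h'' : (inner ℝ (mvfderiv (𝓡 n) f p A) (mvfderiv (𝓡 n) f p w) : ℝ) =
      -inner ℝ (mvfderiv (𝓡 n) ν p v) (mvfderiv (𝓡 n) f p w) := h'
    rw [hx, inner_add_left, h'']
    ring
  rw [eq_neg_iff_add_eq_zero, ← hx]
  by_contra hne
  -- Were x nonzero, the image of df together with f, ν and x would span a space of dimension n + 3
  -- inside ℝ^{n+2}.
  let D : EuclideanSpace ℝ (Fin n) →ₗ[ℝ] RSpace n := (chartDeriv f p).toLinearMap
  let Φ : (EuclideanSpace ℝ (Fin n) × ℝ × ℝ × ℝ) →ₗ[ℝ] RSpace n :=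
    D.coprod ((LinearMap.toSpanSingleton ℝ _ (f p)).coprod
      ((LinearMap.toSpanSingleton ℝ _ (ν p)).coprod (LinearMap.toSpanSingleton ℝ _ x)))
  have hΦ : Function.Injective Φ := by
    rw [← LinearMap.ker_eq_bot, LinearMap.ker_eq_bot']
    rintro ⟨w, a, b, c⟩ h
    have h : D w + (a • f p + (b • ν p + c • x)) = 0 := h
    have hfD : inner ℝ (f p) (D w) = (0 : ℝ) := H.inner_deriv_self p w
    have hνD : inner ℝ (ν p) (D w) = (0 : ℝ) := (real_inner_comm _ _).trans (H.normal p w)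
    have hxD : inner ℝ x (D w) = (0 : ℝ) := hxd w
    have hxf' := (real_inner_comm (f p) x).trans hxf
    have hxν' := (real_inner_comm (ν p) x).trans hxν
    have hνf := (real_inner_comm (f p) (ν p)).trans (H.inner_normal p)
    have hc : c = 0 := by
      have := congrArg (fun y => (inner ℝ x y : ℝ)) h
      simp only [inner_add_right, hxD, inner_smul_right, hxf', hxν',
        inner_zero_right, mul_zero, zero_add, mul_eq_zero, inner_self_eq_zero] at this
      exact this.resolve_right hne
    have ha : a = 0 := by
      have := congrArg (fun y => (inner ℝ (f p) y : ℝ)) h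
      simpa only [inner_add_right, hfD, inner_smul_right, H.inner_self, hxf,
        H.inner_normal, inner_zero_right, mul_zero, mul_one, zero_add, add_zero] using this
    have hb : b = 0 := by
      have := congrArg (fun y => (inner ℝ (ν p) y : ℝ)) h
      simpa only [inner_add_right, hνD, inner_smul_right, hxν, H.inner_normal_self, hνf,
        inner_zero_right, mul_zero, mul_one, zero_add, add_zero] using this
    subst ha hb hc
    have hw : D w = D 0 := by simpa using h
    rw [show w = 0 from hinj hw]; rfl
  have := LinearMap.finrank_le_finrank_of_injective hΦ
  simp at this

/-- The expression of `g((∇_X A) Y, Z)` by derivatives of vector-valued functions. -/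
lemma inducedMetric_covDeriv_shapeOperator (hinj : ∀ p, Function.Injective (mvfderiv (𝓡 n) f p))
    (p : M) {X Y : (q : M) → TangentSpace (𝓡 n) q}
    (hY : MDifferentiableAt (𝓡 n) (𝓡 n) (fieldCoord p Y) p) (z : TangentSpace (𝓡 n) p) :
    inducedMetric f p (leviCivita (inducedMetric f) X (fun q => shapeOperator f ν q (Y q)) p
      - shapeOperator f ν p (leviCivita (inducedMetric f) X Y p)) z =
    inner ℝ (mvfderiv (𝓡 n) (fun q => mvfderiv (𝓡 n) f q (Y q)) p (X p)) (mvfderiv (𝓡 n) ν p z)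
      - inner ℝ (mvfderiv (𝓡 n) (fun q => mvfderiv (𝓡 n) ν q (Y q)) p (X p))
        (mvfderiv (𝓡 n) f p z) := by
  have hW : (fun q => mvfderiv (𝓡 n) f q (shapeOperator f ν q (Y q))) =
      fun q => -mvfderiv (𝓡 n) ν q (Y q) := funext fun q => H.mvfderiv_shapeOperator (hinj q) _
  have hdY := mdifferentiableAt_mvfderiv_apply p H.smooth_normal hY
  have hAY : MDifferentiableAt (𝓡 n) (𝓡 n)
      (fieldCoord p fun q => shapeOperator f ν q (Y q)) p := by
    have hT : DifferentiableAt ℝ (fderiv ℝ (f ∘ (extChartAt (𝓡 n) p).symm)) (extChartAt (𝓡 n) p p) :=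
      (((contDiffAt_comp_extChartAt_symm p H.smooth.contMDiffAt).fderiv_right (m := 1)
        (by norm_num [one_add_one_eq_two])).differentiableAt one_ne_zero)
    refine mdifferentiableAt_of_clm_apply
      (T := fun q => fderiv ℝ (f ∘ (extChartAt (𝓡 n) p).symm) (extChartAt (𝓡 n) p q)) ?_ ?_ ?_
    · exact hT.mdifferentiableAt.comp p (mdifferentiableAt_extChartAt (mem_chart_source _ p))
    · rw [(hasFDerivAt_comp_extChartAt_symm p (H.mdiff p)).fderiv]
      exact hinj p
    · refine hdY.neg.congr_of_eventuallyEq ?_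
      filter_upwards [eventually_mem_chartAt_source (E := EuclideanSpace ℝ (Fin n)) p] with q hq
      exact (mvfderiv_eq_fderiv hq (H.mdiff q) _).symm.trans (congrFun hW q)
  -- The term with A(∇_X Y) is moved onto z: ⟨dν(∇_X Y), df z⟩ = ⟨dν z, df(∇_X Y)⟩ by symmetry, and
  -- since dν z = −df(A z) is tangential, the Gauss formula replaces df(∇_X Y) by D_X(df Y).
  rw [inducedMetric_apply, map_sub, inner_sub_left,
    inner_mvfderiv_leviCivita H.smooth (hinj p) X hAY, hW, H.mvfderiv_shapeOperator (hinj p),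
    inner_neg_left, H.inner_deriv_comm, ← neg_eq_iff_eq_neg.2 (H.mvfderiv_shapeOperator (hinj p) z),
    inner_neg_left,
    real_inner_comm (mvfderiv (𝓡 n) f p (leviCivita _ _ _ _)), inner_mvfderiv_leviCivita H.smooth (hinj p) X hY,
    show (fun q => -mvfderiv (𝓡 n) ν q (Y q)) = -fun q => mvfderiv (𝓡 n) ν q (Y q) from rfl,
    mvfderiv_neg, inner_neg_right]
  simp only [neg_apply, inner_neg_left]
  ring

end NormalPair

end Hypersurface

/-! ### Parallel hypersurfaces: invariance under rotation of the pair (F, ν). -/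

section Rotation

variable {n : ℕ} {M : Type*} [TopologicalSpace M] [ChartedSpace (EuclideanSpace ℝ (Fin n)) M]
  [IsManifold (𝓡 n) ∞ M]

omit [IsManifold (𝓡 n) ∞ M] in
lemma contMDiff_smul_add_smul {V : Type*} [NormedAddCommGroup V] [NormedSpace ℝ V] {f h : M → V}
    {m : ℕ∞ω} (hf : ContMDiff (𝓡 n) 𝓘(ℝ, V) m f) (hh : ContMDiff (𝓡 n) 𝓘(ℝ, V) m h) (a b : ℝ) :
    ContMDiff (𝓡 n) 𝓘(ℝ, V) m fun q => a • f q + b • h q :=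
  ((a • ContinuousLinearMap.id ℝ V).contMDiff.comp hf).add
    ((b • ContinuousLinearMap.id ℝ V).contMDiff.comp hh)

lemma mvfderiv_smul_add_smul {V : Type*} [NormedAddCommGroup V] [NormedSpace ℝ V] {f h : M → V}
    {p : M} (hf : MDifferentiableAt (𝓡 n) 𝓘(ℝ, V) f p) (hh : MDifferentiableAt (𝓡 n) 𝓘(ℝ, V) h p)
    (a b : ℝ) (v : TangentSpace (𝓡 n) p) :
    mvfderiv (𝓡 n) (fun q => a • f q + b • h q) p v =
      a • mvfderiv (𝓡 n) f p v + b • mvfderiv (𝓡 n) h p v := by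
  have h1 := mvfderiv_clm_comp (a • ContinuousLinearMap.id ℝ V) hf v
  have h2 := mvfderiv_clm_comp (b • ContinuousLinearMap.id ℝ V) hh v
  have h3 : MDifferentiableAt (𝓡 n) 𝓘(ℝ, V) (fun q => a • f q) p :=
    (a • ContinuousLinearMap.id ℝ V).differentiableAt.mdifferentiableAt.comp p hf
  have h4 : MDifferentiableAt (𝓡 n) 𝓘(ℝ, V) (fun q => b • h q) p :=
    (b • ContinuousLinearMap.id ℝ V).differentiableAt.mdifferentiableAt.comp p hh
  exact (DFunLike.congr_fun (mvfderiv_add h3 h4) v).trans (congrArg₂ (· + ·) h1 h2)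

namespace NormalPair

variable {f ν : M → RSpace n} (H : NormalPair f ν)
include H

/-- The rotation acts in the plane spanned by f and ν, and df and dν both take values in the
orthogonal complement of that plane. -/
lemma rotate (t : ℝ) : NormalPair (fun p => Real.cos t • f p + Real.sin t • ν p)
    (fun p => -Real.sin t • f p + Real.cos t • ν p) where
  smooth := contMDiff_smul_add_smul H.smooth H.smooth_normal _ _
  smooth_normal := contMDiff_smul_add_smul H.smooth H.smooth_normal _ _
  inner_self p := by
    simp only [inner_add_left, inner_add_right, inner_smul_left, inner_smul_right, H.inner_self,
      H.inner_normal, H.inner_normal_self, real_inner_comm (f p) (ν p), RCLike.conj_to_real]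
    linear_combination Real.cos_sq_add_sin_sq t
  inner_normal_self p := by
    simp only [inner_add_left, inner_add_right, inner_smul_left, inner_smul_right, H.inner_self,
      H.inner_normal, H.inner_normal_self, real_inner_comm (f p) (ν p), RCLike.conj_to_real]
    linear_combination Real.cos_sq_add_sin_sq t
  inner_normal p := by
    simp only [inner_add_left, inner_add_right, inner_smul_left, inner_smul_right, H.inner_self,
      H.inner_normal, H.inner_normal_self, real_inner_comm (f p) (ν p), RCLike.conj_to_real]
    ring
  normal p v := by
    rw [mvfderiv_smul_add_smul (H.mdiff p) (H.mdiff_normal p)]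
    simp only [inner_add_left, inner_add_right, inner_smul_left, inner_smul_right, H.normal,
      RCLike.conj_to_real, real_inner_comm (f p) (mvfderiv (𝓡 n) f p v),
      real_inner_comm (f p) (mvfderiv (𝓡 n) ν p v), H.inner_deriv_self, H.inner_deriv_normal,
      real_inner_comm (ν p) (mvfderiv (𝓡 n) ν p v), H.inner_normal_deriv_normal]
    ring

/-- The form is alternating in the pair (f, ν), so a linear change of the pair multiplies it by the
determinant, here cos² t + sin² t. -/
lemma rotate_form (t : ℝ) (p : M) (X : TangentSpace (𝓡 n) p) {Y : (q : M) → TangentSpace (𝓡 n) q}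
    (hY : MDifferentiableAt (𝓡 n) (𝓡 n) (fieldCoord p Y) p) (z : TangentSpace (𝓡 n) p) :
    inner ℝ (mvfderiv (𝓡 n) (fun q => mvfderiv (𝓡 n)
        (fun p => Real.cos t • f p + Real.sin t • ν p) q (Y q)) p X)
      (mvfderiv (𝓡 n) (fun p => -Real.sin t • f p + Real.cos t • ν p) p z)
    - inner ℝ (mvfderiv (𝓡 n) (fun q => mvfderiv (𝓡 n)
        (fun p => -Real.sin t • f p + Real.cos t • ν p) q (Y q)) p X)
      (mvfderiv (𝓡 n) (fun p => Real.cos t • f p + Real.sin t • ν p) p z) =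
    (inner ℝ (mvfderiv (𝓡 n) (fun q => mvfderiv (𝓡 n) f q (Y q)) p X) (mvfderiv (𝓡 n) ν p z)
    - inner ℝ (mvfderiv (𝓡 n) (fun q => mvfderiv (𝓡 n) ν q (Y q)) p X)
      (mvfderiv (𝓡 n) f p z) : ℝ) := by
  simp only [mvfderiv_smul_add_smul (H.mdiff _) (H.mdiff_normal _)]
  have h1 := mdifferentiableAt_mvfderiv_apply p H.smooth hY
  have h2 := mdifferentiableAt_mvfderiv_apply p H.smooth_normal hY
  rw [mvfderiv_smul_add_smul h1 h2, mvfderiv_smul_add_smul h1 h2]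
  simp only [inner_add_left, inner_add_right, inner_smul_left, inner_smul_right,
      RCLike.conj_to_real]
  set a : ℝ := inner ℝ (mvfderiv (𝓡 n) (fun q => mvfderiv (𝓡 n) f q (Y q)) p X)
    (mvfderiv (𝓡 n) ν p z)
  set b : ℝ := inner ℝ (mvfderiv (𝓡 n) (fun q => mvfderiv (𝓡 n) ν q (Y q)) p X)
    (mvfderiv (𝓡 n) f p z)
  linear_combination (a - b) * Real.cos_sq_add_sin_sq t

end NormalPair

namespace IsoparametricHypersurface

variable (S : IsoparametricHypersurface n M)

omit [IsManifold (𝓡 n) ∞ M] in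
lemma normalPair : NormalPair (fun q => (S.F q : RSpace n)) S.ν where
  smooth := by
    have := Fact.mk (@finrank_euclideanSpace_fin ℝ _ (n + 1 + 1))
    have h1 : ContMDiff (𝓡 (n + 1)) 𝓘(ℝ, RSpace n) ∞
        ((↑) : Metric.sphere (0 : RSpace n) 1 → RSpace n) :=
      contMDiff_coe_sphere (E := RSpace n) (n := n + 1)
    exact (h1.comp S.embedding.contMDiff).of_le ENat.LEInfty.out
  smooth_normal := S.contMDiff_normal.of_le ENat.LEInfty.out
  inner_self p := by rw [real_inner_self_eq_norm_sq]; simp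
  inner_normal_self p := by rw [real_inner_self_eq_norm_sq, S.norm_normal, one_pow]
  inner_normal := S.inner_normal
  normal := S.normal

/-- The right-hand side is free of t. -/
lemma alpha_eq {t : ℝ} (ht : t ∈ S.regularSet) {X Y : (p : M) → TangentSpace (𝓡 n) p}
    (Z : (p : M) → TangentSpace (𝓡 n) p) {p : M}
    (hY : MDifferentiableAt (𝓡 n) (𝓡 n) (fieldCoord p Y) p) :
    S.alpha t X Y Z p =
      inner ℝ (mvfderiv (𝓡 n) (fun q => mvfderiv (𝓡 n) (fun q => (S.F q : RSpace n)) q (Y q)) p (X p))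
        (mvfderiv (𝓡 n) S.ν p (Z p))
      - inner ℝ (mvfderiv (𝓡 n) (fun q => mvfderiv (𝓡 n) S.ν q (Y q)) p (X p))
        (mvfderiv (𝓡 n) (fun q => (S.F q : RSpace n)) p (Z p)) :=
  ((S.normalPair.rotate t).inducedMetric_covDeriv_shapeOperator ht p hY (Z p)).trans
    (S.normalPair.rotate_form t p (X p) hY (Z p))

end IsoparametricHypersurface

end Rotation

/-! ### The affine parametrization of the quadric and its derivative. -/

namespace IsotropicFrame

open Quadric

variable {n : ℕ} (b : IsotropicFrame n)

/-- The coordinates of a vector in the frame, other than the first two. -/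
def tangPart : CSpace n →L[ℂ] EuclideanSpace ℂ (Fin n) :=
  LinearMap.toContinuousLinearMap
    { toFun := fun z => WithLp.toLp 2 fun i => b.basis.repr z i.succ.succ
      map_add' := fun x y => by ext i; simp
      map_smul' := fun c x => by ext i; simp }

lemma tangPart_apply (z : CSpace n) (i : Fin n) : b.tangPart z i = b.basis.repr z i.succ.succ := rfl

lemma inner_eq (x y : CSpace n) : inner ℂ x y =
    (starRingEnd ℂ) (b.basis.repr x 0) * b.basis.repr y 0 +
    (starRingEnd ℂ) (b.basis.repr x 1) * b.basis.repr y 1 +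
    inner ℂ (b.tangPart x) (b.tangPart y) := by
  rw [← b.basis.repr.inner_map_map, PiLp.inner_apply, PiLp.inner_apply, Fin.sum_univ_succ,
    Fin.sum_univ_succ]
  simp only [tangPart_apply, RCLike.inner_apply, ← add_assoc, Fin.succ_zero_eq_one]
  simp only [mul_comm]

lemma tangPart_comb (a c : ℂ) (u : EuclideanSpace ℂ (Fin n)) :
    b.tangPart (a • b.basis 0 + c • b.basis 1 + b.tang u) = u := by
  ext i
  rw [tangPart_apply, repr_comb]
  simp

lemma inner_comb (a c a' c' : ℂ) (u u' : EuclideanSpace ℂ (Fin n)) :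
    inner ℂ (a • b.basis 0 + c • b.basis 1 + b.tang u) (a' • b.basis 0 + c' • b.basis 1 + b.tang u') =
      (starRingEnd ℂ) a * a' + (starRingEnd ℂ) c * c' + inner ℂ u u' := by
  rw [b.inner_eq, tangPart_comb, tangPart_comb, repr_comb, repr_comb, repr_comb, repr_comb]
  simp

lemma tang_add (u v : EuclideanSpace ℂ (Fin n)) : b.tang (u + v) = b.tang u + b.tang v := by
  simp [tang, add_smul, Finset.sum_add_distrib]

lemma tang_smul (c : ℂ) (u : EuclideanSpace ℂ (Fin n)) : b.tang (c • u) = c • b.tang u := by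
  simp [tang, Finset.smul_sum, smul_smul]

lemma cBilin_add_right (x y z : CSpace n) : cBilin x (y + z) = cBilin x y + cBilin x z := by
  rw [cBilin_comm, cBilin_add_left, cBilin_comm y, cBilin_comm z]

lemma cBilin_smul_right (c : ℂ) (x y : CSpace n) : cBilin x (c • y) = c * cBilin x y := by
  rw [cBilin_comm, cBilin_smul_left, cBilin_comm]

/-- `param` is a quadratic polynomial, so its expansion along a line is exact. The zero coefficient
of the first basis vector is kept so that `inner_comb` applies. -/
lemma hasLineDerivAt_param (u a : EuclideanSpace ℂ (Fin n)) :
    HasLineDerivAt ℝ b.param ((0 : ℂ) • b.basis 0 + (-cBilin (b.tang u) (b.tang a)) • b.basis 1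
      + b.tang a) u a := by
  have h (t : ℝ) : b.param (u + t • a) = b.param u + t • ((0 : ℂ) • b.basis 0 +
      (-cBilin (b.tang u) (b.tang a)) • b.basis 1 + b.tang a) +
      (t * t) • ((-(1 / 2 : ℂ) * cBilin (b.tang a) (b.tang a)) • b.basis 1) := by
    rw [← Complex.coe_smul, ← Complex.coe_smul, ← Complex.coe_smul, param, param, tang_add,
      tang_smul]
    simp only [cBilin_add_left, cBilin_add_right, cBilin_smul_left, cBilin_smul_right,
      cBilin_comm (b.tang a) (b.tang u)]
    push_cast
    module
  unfold HasLineDerivAt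
  simp only [h]
  have h1 := (((hasDerivAt_id (0 : ℝ)).smul_const ((0 : ℂ) • b.basis 0 +
      (-cBilin (b.tang u) (b.tang a)) • b.basis 1 + b.tang a)).const_add (b.param u)).add
    (((hasDerivAt_id (0 : ℝ)).mul (hasDerivAt_id (0 : ℝ))).smul_const
      ((-(1 / 2 : ℂ) * cBilin (b.tang a) (b.tang a)) • b.basis 1))
  refine h1.congr_deriv ?_
  simp

lemma fderiv_param (u a : EuclideanSpace ℂ (Fin n)) :
    fderiv ℝ b.param u a = (0 : ℂ) • b.basis 0 + (-cBilin (b.tang u) (b.tang a)) • b.basis 1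
      + b.tang a := by
  have h : DifferentiableAt ℝ b.param u :=
    ((b.contDiff_param (m := 1)).differentiable one_ne_zero u).restrictScalars ℝ
  rw [← h.lineDeriv_eq_fderiv, (b.hasLineDerivAt_param u a).lineDeriv]

end IsotropicFrame

/-! ### The Fubini-Study form in homogeneous coordinates. -/

namespace Quadric

open IsotropicFrame

variable {n : ℕ}

lemma real_inner_eq_re {ι : Type*} [Fintype ι] (x y : EuclideanSpace ℂ ι) :
    inner ℝ x y = (inner ℂ x y).re := by
  simp [PiLp.inner_apply, Complex.inner]

lemma fubiniStudy_apply (z v w : CSpace n) : fubiniStudy z v w =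
    (‖z‖ ^ 2)⁻¹ * (inner ℂ ((ℂ ∙ z)ᗮ.starProjection v) ((ℂ ∙ z)ᗮ.starProjection w)).re := by
  rw [← real_inner_eq_re]
  rfl

lemma starProjection_orthogonal_span (z v : CSpace n) : (ℂ ∙ z)ᗮ.starProjection v =
    v - (inner ℂ z v / (‖z‖ ^ 2 : ℝ)) • z := by
  rw [Submodule.starProjection_orthogonal_val, Submodule.starProjection_singleton]
  rfl

lemma fubiniStudy_eq {z : CSpace n} (hz : z ≠ 0) (v w : CSpace n) : fubiniStudy z v w =
    (‖z‖ ^ 2)⁻¹ * (inner ℂ v w - inner ℂ v z * inner ℂ z w / (‖z‖ ^ 2 : ℝ)).re := by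
  have h : (‖z‖ : ℂ) ≠ 0 := by simpa using hz
  rw [fubiniStudy_apply, starProjection_orthogonal_span, starProjection_orthogonal_span]
  congr 2
  simp only [inner_sub_left, inner_sub_right, inner_smul_left, inner_smul_right, map_div₀,
    inner_conj_symm, Complex.conj_ofReal, inner_self_eq_norm_sq_to_K]
  push_cast
  simp only [Complex.coe_algebraMap]
  field_simp
  ring

/-- The Fubini-Study form does not depend on the lift. -/
lemma fubiniStudy_smul {z : CSpace n} {c : ℂ} (hc : c ≠ 0) (v w : CSpace n) (a a' : ℂ) :
    fubiniStudy (c • z) (c • v + a • z) (c • w + a' • z) = fubiniStudy z v w := by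
  have hs : (ℂ ∙ (c • z)) = ℂ ∙ z := Submodule.span_singleton_smul_eq (IsUnit.mk0 c hc) z
  have hz : (ℂ ∙ z)ᗮ.starProjection z = 0 := by
    rw [Submodule.starProjection_orthogonal_val, sub_eq_zero, eq_comm,
      Submodule.starProjection_eq_self_iff]
    exact Submodule.mem_span_singleton_self z
  rw [fubiniStudy_apply, fubiniStudy_apply]
  simp only [hs, map_add, map_smul, hz, smul_zero, add_zero, inner_smul_left, inner_smul_right,
    norm_smul]
  rw [← mul_assoc, Complex.mul_conj, Complex.re_ofReal_mul,
    Complex.normSq_eq_norm_sq]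
  have : ‖c‖ ≠ 0 := norm_ne_zero_iff.2 hc
  by_cases hz0 : z = 0
  · simp [hz0]
  have : ‖z‖ ≠ 0 := norm_ne_zero_iff.2 hz0
  field_simp

end Quadric

/-! ### The Kähler metric in a centred affine chart. -/

namespace Quadric

open IsotropicFrame

variable {n : ℕ}

lemma differentiable_param (b : IsotropicFrame n) : Differentiable ℝ b.param :=
  fun u => ((b.contDiff_param (m := 1)).differentiable one_ne_zero u).restrictScalars ℝ

lemma extChartAt_apply (q y : Quadric n) :
    extChartAt 𝓘(ℝ, EuclideanSpace ℂ (Fin n)) q y = q.frame.coord y.rep.1 := rfl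

lemma extChartAt_symm_apply (q : Quadric n) (u : EuclideanSpace ℂ (Fin n)) :
    (extChartAt 𝓘(ℝ, EuclideanSpace ℂ (Fin n)) q).symm u = q.frame.toQuadric u := rfl

lemma mem_extChartAt_target (q : Quadric n) (u : EuclideanSpace ℂ (Fin n)) :
    u ∈ (extChartAt 𝓘(ℝ, EuclideanSpace ℂ (Fin n)) q).target := by
  rw [extChartAt_target]
  exact ⟨trivial, u, rfl⟩

lemma coord_basis_zero (b : IsotropicFrame n) : b.coord (b.basis 0) = 0 := by
  ext i
  simp only [coord, b.basis.repr_self]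
  simp [EuclideanSpace.single]

lemma extChartAt_self (q : Quadric n) :
    extChartAt 𝓘(ℝ, EuclideanSpace ℂ (Fin n)) q q = 0 := by
  rw [extChartAt_apply, ← coord_basis_zero q.frame, frame_zero, coord_smul]
  simpa using q.rep.2.1

lemma mem_chartAt_source_iff (q y : Quadric n) :
    y ∈ (chartAt (EuclideanSpace ℂ (Fin n)) q).source ↔ q.frame.basis.repr y.rep.1 0 ≠ 0 := Iff.rfl

lemma localLift_comp_extChartAt_symm (q y : Quadric n) (u : EuclideanSpace ℂ (Fin n))
    (h : y.frame.basis.repr (q.frame.param u) 0 ≠ 0) :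
    (y.localLift ∘ (extChartAt 𝓘(ℝ, EuclideanSpace ℂ (Fin n)) q).symm) u =
      (y.frame.basis.repr (q.frame.param u) 0)⁻¹ • q.frame.param u := by
  change y.frame.param (y.frame.coord (q.frame.toQuadric u).rep.1) = _
  rw [toQuadric, coord_rep, param_coord _ (q.frame.bilin_param u) h]

lemma mdifferentiableAt_localLift (y : Quadric n) :
    MDifferentiableAt 𝓘(ℝ, EuclideanSpace ℂ (Fin n)) 𝓘(ℝ, CSpace n) y.localLift y :=
  (differentiable_param y.frame _).mdifferentiableAt.comp y
    (mdifferentiableAt_extChartAt (I := 𝓘(ℝ, EuclideanSpace ℂ (Fin n))) (mem_chart_source _ y))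

/-- The metric of the quadric in a chart. -/
lemma metricInChart_kahlerMetric (q : Quadric n) (u a a' : EuclideanSpace ℂ (Fin n)) :
    metricInChart (kahlerMetric n) q u a a' = fubiniStudy (q.frame.param u)
      (fderiv ℝ q.frame.param u a) (fderiv ℝ q.frame.param u a') := by
  set y : Quadric n := (extChartAt 𝓘(ℝ, EuclideanSpace ℂ (Fin n)) q).symm u with hy
  have hne : y.frame.basis.repr (q.frame.param u) 0 ≠ 0 := by
    have h := (mem_chartAt_source_iff y y).1 (mem_chart_source _ y)
    rw [hy, extChartAt_symm_apply, toQuadric] at h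
    exact (repr_rep_ne_zero_iff _ _).1 h
  have hopen : ∀ᶠ v in 𝓝 u, y.frame.basis.repr (q.frame.param v) 0 ≠ 0 :=
    ((differentiable_param q.frame).continuous.continuousAt.eventually
      ((isOpen_ne_fun (f := fun z => y.frame.basis.repr z 0) (by fun_prop)
        continuous_const).mem_nhds hne))
  -- At y the metric is defined by the lift of the frame chosen at y, which near u is c times the
  -- parametrization of the frame at q. Differentiating c only adds a multiple of the lift, which
  -- the Fubini-Study form ignores.
  set c : EuclideanSpace ℂ (Fin n) → ℂ := fun v => (y.frame.basis.repr (q.frame.param v) 0)⁻¹ with hc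
  have hcd : DifferentiableAt ℝ c u := by
    refine DifferentiableAt.inv ?_ hne
    have h1 : Differentiable ℝ fun z => y.frame.basis.repr z 0 := by
      have : Differentiable ℂ fun z => y.frame.basis.repr z 0 := by fun_prop
      exact this.restrictScalars ℝ
    exact (h1 _).comp u (differentiable_param q.frame u)
  have hlift : y.localLift ∘ (extChartAt 𝓘(ℝ, EuclideanSpace ℂ (Fin n)) q).symm =ᶠ[𝓝 u]
      fun v => c v • q.frame.param v := by
    filter_upwards [hopen] with v hv
    exact localLift_comp_extChartAt_symm q y v hv
  have hD (w : EuclideanSpace ℂ (Fin n)) :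
      mvfderiv 𝓘(ℝ, EuclideanSpace ℂ (Fin n)) y.localLift y
        (mfderiv 𝓘(ℝ, EuclideanSpace ℂ (Fin n)) 𝓘(ℝ, EuclideanSpace ℂ (Fin n))
          (extChartAt 𝓘(ℝ, EuclideanSpace ℂ (Fin n)) q).symm u w) =
      c u • fderiv ℝ q.frame.param u w + fderiv ℝ c u w • q.frame.param u := by
    refine (mvfderiv_extChartAt_symm q (mem_extChartAt_target q u)
      (mdifferentiableAt_localLift y) w).trans ?_
    rw [hlift.fderiv_eq, fderiv_fun_smul hcd (differentiable_param q.frame u)]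
    simp
  have h0 : y.localLift y = c u • q.frame.param u := hlift.eq_of_nhds
  refine (congrArg₂ (fun s t => fubiniStudy (y.localLift y) s t) (hD a) (hD a')).trans ?_
  rw [h0, fubiniStudy_smul (inv_ne_zero hne)]

lemma tang_zero (b : IsotropicFrame n) : b.tang 0 = 0 := by simp [tang]

lemma tang_neg (b : IsotropicFrame n) (u : EuclideanSpace ℂ (Fin n)) : b.tang (-u) = -b.tang u := by
  simp [tang]

lemma fubiniStudy_param_zero (b : IsotropicFrame n) (a a' : EuclideanSpace ℂ (Fin n)) :
    fubiniStudy (b.param 0) (fderiv ℝ b.param 0 a) (fderiv ℝ b.param 0 a') =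
      (inner ℂ a a').re := by
  have h0 : b.param 0 = (1 : ℂ) • b.basis 0 + (0 : ℂ) • b.basis 1 + b.tang 0 := by
    rw [param_eq]; simp [tang_zero, cBilin]
  have hn : ‖b.param 0‖ = 1 := by
    rw [h0]; simp [tang_zero]
  rw [fubiniStudy_eq (b.param_ne_zero 0), hn, fderiv_param,
    fderiv_param, inner_comb, h0, inner_comb, inner_comb]
  simp [tang_zero, cBilin]

/-- The unitary map that fixes the first two frame vectors and negates the others induces u ↦ −u in
the chart: it is the geodesic symmetry of the quadric at q. In formulas, all signs occur in pairs.
-/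
lemma metricInChart_kahlerMetric_neg (q : Quadric n) (u : EuclideanSpace ℂ (Fin n)) :
    metricInChart (kahlerMetric n) q (-u) = metricInChart (kahlerMetric n) q u := by
  ext a a'
  have hneg (x y : CSpace n) : cBilin (-x) y = -cBilin x y := by
    rw [← neg_one_smul ℂ, cBilin_smul_left, neg_one_mul]
  have hneg' (x y : CSpace n) : cBilin x (-y) = -cBilin x y := by
    rw [cBilin_comm, hneg, cBilin_comm]
  have hn : ‖q.frame.param (-u)‖ ^ 2 = ‖q.frame.param u‖ ^ 2 := by
    have h (v : EuclideanSpace ℂ (Fin n)) : ‖q.frame.param v‖ ^ 2 =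
        (inner ℂ (q.frame.param v) (q.frame.param v)).re := (inner_self_eq_norm_sq (𝕜 := ℂ) _).symm
    rw [h, h, param_eq, param_eq, inner_comb, inner_comb]
    simp [tang_neg, hneg, hneg']
  rw [metricInChart_kahlerMetric, metricInChart_kahlerMetric,
    fubiniStudy_eq (q.frame.param_ne_zero _), fubiniStudy_eq (q.frame.param_ne_zero _), hn]
  simp only [fderiv_param]
  rw [param_eq, param_eq]
  simp only [inner_comb]
  simp only [tang_neg, hneg, hneg', inner_neg_left, inner_neg_right, map_neg, neg_neg, map_zero,
    zero_mul, mul_zero, zero_add]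
  congr 4 <;> ring

lemma fderiv_zero_of_even {E V : Type*} [NormedAddCommGroup E] [NormedSpace ℝ E]
    [NormedAddCommGroup V] [NormedSpace ℝ V] {f : E → V} (hf : ∀ u, f (-u) = f u) :
    fderiv ℝ f 0 = 0 := by
  by_cases hd : DifferentiableAt ℝ f 0
  · have h0 : HasFDerivAt (fun u : E => -u) (-ContinuousLinearMap.id ℝ E) 0 :=
      (hasFDerivAt_id (𝕜 := ℝ) _).fun_neg
    have h1 : HasFDerivAt f (fderiv ℝ f 0) ((fun u : E => -u) 0) := by
      beta_reduce; rw [neg_zero]; exact hd.hasFDerivAt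
    have h2 := HasFDerivAt.comp (f := fun u : E => -u) 0 h1 h0
    rw [show f ∘ (fun u => -u) = f from funext hf] at h2
    ext1 a
    have h3 := congrArg (fun L => L a) (h2.unique hd.hasFDerivAt)
    simp only [ContinuousLinearMap.comp_apply, neg_apply, ContinuousLinearMap.id_apply,
      map_neg] at h3
    rw [zero_apply]
    have h4 : (2 : ℝ) • fderiv ℝ f 0 a = 0 := by
      rw [two_smul]; nth_rewrite 1 [← h3]; exact neg_add_cancel _
    exact (smul_eq_zero.1 h4).resolve_left two_ne_zero
  -- The default value of `fderiv` is zero, so the regularity of the metric need not be checked.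
  · exact fderiv_zero_of_not_differentiableAt hd

/-- The centre has coordinate 0, where the even function `metricInChart` has zero derivative. -/
lemma christoffel_kahlerMetric (q : Quadric n) (a a' : EuclideanSpace ℂ (Fin n)) :
    christoffel (kahlerMetric n) q a a' = 0 := by
  have h : fderiv ℝ (metricInChart (kahlerMetric n) q) 0 = 0 :=
    fderiv_zero_of_even (metricInChart_kahlerMetric_neg q)
  unfold christoffel
  simp only [extChartAt_self, h]
  simp

lemma kahlerMetric_apply (q : Quadric n)
    (v w : TangentSpace 𝓘(ℝ, EuclideanSpace ℂ (Fin n)) q) :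
    kahlerMetric n q v w =
      (@inner ℂ (EuclideanSpace ℂ (Fin n)) _ v w).re := by
  have h0 : q.localLift ∘ (extChartAt 𝓘(ℝ, EuclideanSpace ℂ (Fin n)) q).symm = q.frame.param := by
    ext1 u
    have h1 := q.frame.repr_param_zero u
    rw [localLift_comp_extChartAt_symm q q u (by simp [h1]), h1]
    simp
  have h1 (v : TangentSpace 𝓘(ℝ, EuclideanSpace ℂ (Fin n)) q) :
      mvfderiv 𝓘(ℝ, EuclideanSpace ℂ (Fin n)) q.localLift q v = fderiv ℝ q.frame.param 0 v := by
    rw [mvfderiv_eq_fderiv (mem_chart_source _ q) (mdifferentiableAt_localLift q), h0,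
      extChartAt_self, tangentCoord_self]
  have h2 : q.localLift q = q.frame.param 0 :=
    congrArg q.frame.param (extChartAt_self q)
  change fubiniStudy (q.localLift q) (mvfderiv _ q.localLift q v) (mvfderiv _ q.localLift q w) = _
  rw [h1, h1, h2]
  exact fubiniStudy_param_zero q.frame v w

end Quadric

/-! ### Complex structure and covariant derivative of the quadric. -/

namespace Quadric

variable {n : ℕ}

/-- J is multiplication by i in the chart centred at y; the transition to the chart at q is
holomorphic, so its real derivative commutes with i. -/
lemma tangentCoord_complexStructure {q y : Quadric n}
    (hy : y ∈ (chartAt (EuclideanSpace ℂ (Fin n)) q).source)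
    (v : TangentSpace 𝓘(ℝ, EuclideanSpace ℂ (Fin n)) y) :
    tangentCoord q y (y.complexStructure v) = Complex.I • tangentCoord q y v := by
  have hd : MDifferentiableAt 𝓘(ℝ, EuclideanSpace ℂ (Fin n)) 𝓘(ℝ, EuclideanSpace ℂ (Fin n))
      (extChartAt 𝓘(ℝ, EuclideanSpace ℂ (Fin n)) q) y := mdifferentiableAt_extChartAt hy
  set φ := extChartAt 𝓘(ℝ, EuclideanSpace ℂ (Fin n)) q ∘
    (extChartAt 𝓘(ℝ, EuclideanSpace ℂ (Fin n)) y).symm with hφ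
  set u := extChartAt 𝓘(ℝ, EuclideanSpace ℂ (Fin n)) y y with hu
  have h1 (w : EuclideanSpace ℂ (Fin n)) : tangentCoord q y w = fderiv ℝ φ u w :=
    (mvfderiv_eq_fderiv (mem_chart_source _ y) hd w).trans (congrArg _ (tangentCoord_self y w))
  have h2 : DifferentiableAt ℂ φ u := by
    have hmem : u ∈ (y.frame.chart.symm ≫ₕ q.frame.chart).source := by
      rw [OpenPartialHomeomorph.trans_source]
      refine ⟨trivial, ?_⟩
      change (extChartAt 𝓘(ℝ, EuclideanSpace ℂ (Fin n)) y).symm u ∈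
        (chartAt (EuclideanSpace ℂ (Fin n)) q).source
      rw [hu, extChartAt_to_inv]
      exact hy
    exact ((y.frame.contDiffOn_change q.frame (m := 1)).contDiffAt
      ((OpenPartialHomeomorph.open_source _).mem_nhds hmem)).differentiableAt one_ne_zero
  have h3 : fderiv ℝ φ u = (fderiv ℂ φ u).restrictScalars ℝ := h2.fderiv_restrictScalars ℝ
  refine (h1 (Complex.I • (show EuclideanSpace ℂ (Fin n) from v))).trans ?_
  rw [h3, ContinuousLinearMap.coe_restrictScalars', map_smul]
  congr 1
  exact ((h1 v).trans (DFunLike.congr_fun h3 _)).symm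

lemma covDerivAlong_kahlerMetric {E : Type*} [NormedAddCommGroup E] [NormedSpace ℝ E]
    {M : Type*} [TopologicalSpace M] [ChartedSpace E M] (f : M → Quadric n)
    (V : (q : M) → TangentSpace 𝓘(ℝ, EuclideanSpace ℂ (Fin n)) (f q)) (p : M)
    (v : TangentSpace 𝓘(ℝ, E) p) :
    covDerivAlong (kahlerMetric n) f V p v =
      mvfderiv 𝓘(ℝ, E) (fun q => tangentCoord (f p) (f q) (V q)) p v := by
  unfold covDerivAlong
  simp only [christoffel_kahlerMetric, add_zero]
  rw [mfderiv_extChartAt_self]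
  erw [ContinuousLinearMap.inverse_id]
  rfl

end Quadric

/-! ### Complex combinations (x + i y)/√2 and their Hermitian products. -/

section Stiefel

variable {n : ℕ}

/-- The inclusion of `ℝ^{n+2}` in `ℂ^{n+2}`. -/
def complexify (n : ℕ) : RSpace n →L[ℝ] CSpace n :=
  LinearMap.toContinuousLinearMap
    { toFun := fun x => WithLp.toLp 2 fun i => (x i : ℂ)
      map_add' := fun x y => by ext i; simp
      map_smul' := fun c x => by ext i; simp }

lemma complexify_apply (x : RSpace n) (i : Fin (n + 2)) : complexify n x i = (x i : ℂ) := rfl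

lemma inner_complexify (x y : RSpace n) :
    inner ℂ (complexify n x) (complexify n y) = ((inner ℝ x y : ℝ) : ℂ) := by
  simp [PiLp.inner_apply, complexify_apply]

/-- The vector `(x + i y) / √2`. -/
def stiefelComb (x y : RSpace n) : CSpace n :=
  (((Real.sqrt 2 : ℝ) : ℂ)⁻¹ • complexify n) x +
    ((((Real.sqrt 2 : ℝ) : ℂ)⁻¹ * Complex.I) • complexify n) y

/-- The imaginary part is the alternating pairing behind the cubic form; the factor ½ is where the 2
of the theorem comes from. -/
lemma inner_stiefelComb (x y x' y' : RSpace n) :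
    inner ℂ (stiefelComb x y) (stiefelComb x' y') = (1 / 2 : ℂ) *
      (((inner ℝ x x' + inner ℝ y y' : ℝ) : ℂ) +
        ((inner ℝ x y' - inner ℝ y x' : ℝ) : ℂ) * Complex.I) := by
  have h : ((Real.sqrt 2 : ℝ) : ℂ)⁻¹ * ((Real.sqrt 2 : ℝ) : ℂ)⁻¹ = 1 / 2 := by
    rw [← mul_inv, ← Complex.ofReal_mul, Real.mul_self_sqrt zero_le_two]
    norm_num
  simp only [stiefelComb, smul_apply, inner_add_left, inner_add_right,
    inner_smul_left, inner_smul_right, inner_complexify, map_mul, map_inv₀, Complex.conj_ofReal,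
    Complex.conj_I]
  push_cast
  linear_combination (((inner ℝ x x' : ℝ) : ℂ) + ((inner ℝ x y' : ℝ) : ℂ) * Complex.I
    - ((inner ℝ y x' : ℝ) : ℂ) * Complex.I + ((inner ℝ y y' : ℝ) : ℂ)) * h -
      ((Real.sqrt 2 : ℝ) : ℂ)⁻¹ * ((Real.sqrt 2 : ℝ) : ℂ)⁻¹ * ((inner ℝ y y' : ℝ) : ℂ) * Complex.I_sq

lemma cConj_stiefelComb (x y : RSpace n) : cConj (stiefelComb x y) = stiefelComb x (-y) := by
  ext i
  simp [cConj, stiefelComb, complexify_apply]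

variable {M : Type*} [TopologicalSpace M] [ChartedSpace (EuclideanSpace ℝ (Fin n)) M]
  [IsManifold (𝓡 n) ∞ M]

omit [IsManifold (𝓡 n) ∞ M] in
lemma mdifferentiableAt_stiefelComb {f h : M → RSpace n} {p : M}
    (hf : MDifferentiableAt (𝓡 n) 𝓘(ℝ, RSpace n) f p)
    (hh : MDifferentiableAt (𝓡 n) 𝓘(ℝ, RSpace n) h p) :
    MDifferentiableAt (𝓡 n) 𝓘(ℝ, CSpace n) (fun q => stiefelComb (f q) (h q)) p :=
  (((((Real.sqrt 2 : ℝ) : ℂ)⁻¹ • complexify n)).differentiableAt.mdifferentiableAt.comp p hf).add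
    (((((Real.sqrt 2 : ℝ) : ℂ)⁻¹ * Complex.I) • complexify n).differentiableAt.mdifferentiableAt.comp
      p hh)

lemma mvfderiv_stiefelComb {f h : M → RSpace n} {p : M}
    (hf : MDifferentiableAt (𝓡 n) 𝓘(ℝ, RSpace n) f p)
    (hh : MDifferentiableAt (𝓡 n) 𝓘(ℝ, RSpace n) h p) (v : TangentSpace (𝓡 n) p) :
    mvfderiv (𝓡 n) (fun q => stiefelComb (f q) (h q)) p v =
      stiefelComb (mvfderiv (𝓡 n) f p v) (mvfderiv (𝓡 n) h p v) := by
  have h1 := ((((Real.sqrt 2 : ℝ) : ℂ)⁻¹ • complexify n)).differentiableAt.mdifferentiableAt.comp p hf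
  have h2 := ((((Real.sqrt 2 : ℝ) : ℂ)⁻¹ *
    Complex.I) • complexify n).differentiableAt.mdifferentiableAt.comp p hh
  exact (DFunLike.congr_fun (mvfderiv_add h1 h2) v).trans
    (congrArg₂ (· + ·) (mvfderiv_clm_comp (((Real.sqrt 2 : ℝ) : ℂ)⁻¹ • complexify n) hf v)
      (mvfderiv_clm_comp ((((Real.sqrt 2 : ℝ) : ℂ)⁻¹ * Complex.I) • complexify n) hh v))

end Stiefel

/-! ### Derivatives of a lift read in affine coordinates. -/

section ChartOfLift

variable {n : ℕ} {E : Type*} [NormedAddCommGroup E] [NormedSpace ℝ E]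
  {M : Type*} [TopologicalSpace M] [ChartedSpace E M] [IsManifold 𝓘(ℝ, E) 1 M]

omit [IsManifold 𝓘(ℝ, E) 1 M] in
lemma mdifferentiableAt_inv {g : M → ℂ} {p : M}
    (hg : MDifferentiableAt 𝓘(ℝ, E) 𝓘(ℝ, ℂ) g p) (h0 : g p ≠ 0) :
    MDifferentiableAt 𝓘(ℝ, E) 𝓘(ℝ, ℂ) (fun q => (g q)⁻¹) p :=
  (((differentiableAt_id (𝕜 := ℝ) (x := g p)).inv h0).mdifferentiableAt.comp p hg)

lemma mvfderiv_inv {g : M → ℂ} {p : M} (hg : MDifferentiableAt 𝓘(ℝ, E) 𝓘(ℝ, ℂ) g p)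
    (h0 : g p ≠ 0) (v : TangentSpace 𝓘(ℝ, E) p) :
    mvfderiv 𝓘(ℝ, E) (fun q => (g q)⁻¹) p v = -((g p)⁻¹ ^ 2 * mvfderiv 𝓘(ℝ, E) g p v) := by
  have h1 := mvfderiv_bilin (ContinuousLinearMap.mul ℝ ℂ) (mdifferentiableAt_inv hg h0) hg v
  have h2 : (fun q => ContinuousLinearMap.mul ℝ ℂ (g q)⁻¹ (g q)) =ᶠ[𝓝 p] fun _ => 1 := by
    filter_upwards [hg.continuousAt.eventually_ne h0] with q hq
    exact inv_mul_cancel₀ hq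
  rw [mvfderiv_congr h2, mvfderiv_const] at h1
  have h3 : 0 = (g p)⁻¹ * mvfderiv 𝓘(ℝ, E) g p v
    + mvfderiv 𝓘(ℝ, E) (fun q => (g q)⁻¹) p v * g p := h1
  have h4 := congrArg (· * (g p)⁻¹) h3
  simp only [add_mul, mul_assoc, mul_inv_cancel₀ h0] at h4
  linear_combination -h4

namespace IsotropicFrame

variable (b : IsotropicFrame n)

/-- The first coordinate in the frame. -/
def scal : CSpace n →L[ℂ] ℂ := innerSL ℂ (b.basis 0)

lemma scal_apply (z : CSpace n) : b.scal z = b.basis.repr z 0 := by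
  rw [OrthonormalBasis.repr_apply_apply]; rfl

lemma coord_eq (z : CSpace n) : b.coord z = (b.scal z)⁻¹ • b.tangPart z := by
  ext i
  simp [coord, scal_apply, tangPart_apply, div_eq_inv_mul]

variable {w : M → CSpace n} {p : M}

omit [IsManifold 𝓘(ℝ, E) 1 M] in
lemma mdifferentiableAt_scal (hw : MDifferentiableAt 𝓘(ℝ, E) 𝓘(ℝ, CSpace n) w p) :
    MDifferentiableAt 𝓘(ℝ, E) 𝓘(ℝ, ℂ) (fun q => b.scal (w q)) p :=
  (b.scal.restrictScalars ℝ).differentiableAt.mdifferentiableAt.comp p hw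

omit [IsManifold 𝓘(ℝ, E) 1 M] in
lemma mdifferentiableAt_tangPart (hw : MDifferentiableAt 𝓘(ℝ, E) 𝓘(ℝ, CSpace n) w p) :
    MDifferentiableAt 𝓘(ℝ, E) 𝓘(ℝ, EuclideanSpace ℂ (Fin n)) (fun q => b.tangPart (w q)) p :=
  (b.tangPart.restrictScalars ℝ).differentiableAt.mdifferentiableAt.comp p hw

omit [IsManifold 𝓘(ℝ, E) 1 M] in
lemma mdifferentiableAt_smul {g : M → ℂ} {f : M → EuclideanSpace ℂ (Fin n)}
    (hg : MDifferentiableAt 𝓘(ℝ, E) 𝓘(ℝ, ℂ) g p)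
    (hf : MDifferentiableAt 𝓘(ℝ, E) 𝓘(ℝ, EuclideanSpace ℂ (Fin n)) f p) :
    MDifferentiableAt 𝓘(ℝ, E) 𝓘(ℝ, EuclideanSpace ℂ (Fin n)) (fun q => g q • f q) p :=
  (((ContinuousLinearMap.lsmul ℝ ℂ : ℂ →L[ℝ] EuclideanSpace ℂ (Fin n) →L[ℝ]
    EuclideanSpace ℂ (Fin n)).differentiableAt.mdifferentiableAt.comp p hg).clm_apply hf :)

lemma mvfderiv_complex_smul {g : M → ℂ} {f : M → EuclideanSpace ℂ (Fin n)}
    (hg : MDifferentiableAt 𝓘(ℝ, E) 𝓘(ℝ, ℂ) g p)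
    (hf : MDifferentiableAt 𝓘(ℝ, E) 𝓘(ℝ, EuclideanSpace ℂ (Fin n)) f p)
    (v : TangentSpace 𝓘(ℝ, E) p) :
    mvfderiv 𝓘(ℝ, E) (fun q => g q • f q) p v =
      g p • mvfderiv 𝓘(ℝ, E) f p v + mvfderiv 𝓘(ℝ, E) g p v • f p :=
  mvfderiv_bilin (ContinuousLinearMap.lsmul ℝ ℂ) hg hf v

omit [IsManifold 𝓘(ℝ, E) 1 M] in
lemma mdifferentiableAt_coord (hw : MDifferentiableAt 𝓘(ℝ, E) 𝓘(ℝ, CSpace n) w p)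
    (h0 : b.scal (w p) ≠ 0) :
    MDifferentiableAt 𝓘(ℝ, E) 𝓘(ℝ, EuclideanSpace ℂ (Fin n)) (fun q => b.coord (w q)) p := by
  simp only [coord_eq]
  exact mdifferentiableAt_smul (mdifferentiableAt_inv (b.mdifferentiableAt_scal hw) h0)
    (b.mdifferentiableAt_tangPart hw)

lemma mvfderiv_coord (hw : MDifferentiableAt 𝓘(ℝ, E) 𝓘(ℝ, CSpace n) w p)
    (h0 : b.scal (w p) ≠ 0) (v : TangentSpace 𝓘(ℝ, E) p) :
    mvfderiv 𝓘(ℝ, E) (fun q => b.coord (w q)) p v =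
      (b.scal (w p))⁻¹ • b.tangPart (mvfderiv 𝓘(ℝ, E) w p v) -
      ((b.scal (w p))⁻¹ ^ 2 * b.scal (mvfderiv 𝓘(ℝ, E) w p v)) • b.tangPart (w p) := by
  simp only [coord_eq]
  rw [mvfderiv_complex_smul (mdifferentiableAt_inv (b.mdifferentiableAt_scal hw) h0)
    (b.mdifferentiableAt_tangPart hw), mvfderiv_inv (b.mdifferentiableAt_scal hw) h0]
  have h1 := mvfderiv_clm_comp (b.scal.restrictScalars ℝ) hw v
  have h2 := mvfderiv_clm_comp (b.tangPart.restrictScalars ℝ) hw v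
  simp only [ContinuousLinearMap.coe_restrictScalars'] at h1 h2
  rw [h1, h2, neg_smul, sub_eq_add_neg]

/-- The derivative of `d(coord w)(X)` at a point where `w` is proportional to the first vector of
the frame, provided that the derivatives of `w` have no component along that vector. -/
lemma mvfderiv_mvfderiv_coord (hw : ∀ q, MDifferentiableAt 𝓘(ℝ, E) 𝓘(ℝ, CSpace n) w q)
    (h0 : b.scal (w p) ≠ 0) (hp : b.tangPart (w p) = 0)
    (hd : ∀ v : TangentSpace 𝓘(ℝ, E) p, b.scal (mvfderiv 𝓘(ℝ, E) w p v) = 0)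
    {X : (q : M) → TangentSpace 𝓘(ℝ, E) q}
    (hX : MDifferentiableAt 𝓘(ℝ, E) 𝓘(ℝ, CSpace n) (fun q => mvfderiv 𝓘(ℝ, E) w q (X q)) p)
    (v : TangentSpace 𝓘(ℝ, E) p) :
    MDifferentiableAt 𝓘(ℝ, E) 𝓘(ℝ, EuclideanSpace ℂ (Fin n))
      (fun q => mvfderiv 𝓘(ℝ, E) (fun q => b.coord (w q)) q (X q)) p ∧
    mvfderiv 𝓘(ℝ, E) (fun q => mvfderiv 𝓘(ℝ, E) (fun q => b.coord (w q)) q (X q)) p v =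
      (b.scal (w p))⁻¹ •
        b.tangPart (mvfderiv 𝓘(ℝ, E) (fun q => mvfderiv 𝓘(ℝ, E) w q (X q)) p v) := by
  have hev : (fun q => mvfderiv 𝓘(ℝ, E) (fun q => b.coord (w q)) q (X q)) =ᶠ[𝓝 p]
      (fun q => (b.scal (w q))⁻¹ • b.tangPart (mvfderiv 𝓘(ℝ, E) w q (X q))) -
      fun q => ((b.scal (w q))⁻¹ ^ 2 * b.scal (mvfderiv 𝓘(ℝ, E) w q (X q))) •
        b.tangPart (w q) := by
    filter_upwards [(b.mdifferentiableAt_scal (hw p)).continuousAt.eventually_ne h0] with q hq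
    exact b.mvfderiv_coord (hw q) hq (X q)
  have hr := mdifferentiableAt_inv (b.mdifferentiableAt_scal (hw p)) h0
  have hc : MDifferentiableAt 𝓘(ℝ, E) 𝓘(ℝ, ℂ)
      (fun q => (b.scal (w q))⁻¹ ^ 2 * b.scal (mvfderiv 𝓘(ℝ, E) w q (X q))) p := by
    simp only [sq]
    exact (hr.mul hr).mul (b.mdifferentiableAt_scal hX)
  have h1 := mdifferentiableAt_smul hr (b.mdifferentiableAt_tangPart hX)
  have h2 := mdifferentiableAt_smul hc (b.mdifferentiableAt_tangPart (hw p))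
  refine ⟨(h1.sub h2).congr_of_eventuallyEq hev, ?_⟩
  have h3 := mvfderiv_clm_comp (b.tangPart.restrictScalars ℝ) hX v
  have h4 := mvfderiv_clm_comp (b.scal.restrictScalars ℝ) (hw p) v
  simp only [ContinuousLinearMap.coe_restrictScalars'] at h3 h4
  rw [mvfderiv_congr hev, mvfderiv_sub h1 h2]
  refine (congrArg₂ (· - ·) (mvfderiv_complex_smul hr (b.mdifferentiableAt_tangPart hX) v)
    (mvfderiv_complex_smul hc (b.mdifferentiableAt_tangPart (hw p)) v)).trans ?_
  -- At p the derivative of the reciprocal of `scal` vanishes by `hd`, and the second summand is a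
  -- product of two factors that both vanish at p.
  rw [mvfderiv_inv (b.mdifferentiableAt_scal (hw p)) h0, h3, h4, hd, hd, hp]
  simp

end IsotropicFrame

end ChartOfLift

/-! ### The Lagrangian immersion and its second fundamental form. -/

namespace IsoparametricHypersurface

variable {n : ℕ} {M : Type*} [TopologicalSpace M] [ChartedSpace (EuclideanSpace ℝ (Fin n)) M]
  (S : IsoparametricHypersurface n M)

lemma stiefelLift_eq : S.stiefelLift = fun p => stiefelComb (S.F p : RSpace n) (S.ν p) := by
  ext p i
  simp only [stiefelLift, stiefelComb, smul_apply, PiLp.add_apply, PiLp.smul_apply,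
    complexify_apply, smul_eq_mul]
  ring

lemma inner_stiefelLift_self (p : M) : inner ℂ (S.stiefelLift p) (S.stiefelLift p) = 1 := by
  have H := S.normalPair
  rw [stiefelLift_eq, inner_stiefelComb, H.inner_self p, H.inner_normal_self p, H.inner_normal p,
    real_inner_comm, H.inner_normal p]
  norm_num

lemma norm_stiefelLift (p : M) : ‖S.stiefelLift p‖ = 1 := by
  have h := S.inner_stiefelLift_self p
  have h' : ‖S.stiefelLift p‖ ^ 2 = 1 := by
    rw [← inner_self_eq_norm_sq (𝕜 := ℂ), h]
    exact Complex.one_re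
  exact (pow_eq_one_iff_of_nonneg (norm_nonneg _) two_ne_zero).1 h'

/-- The frame comes from an arbitrary representative, so it matches the lift only up to a phase;
unit phases cancel in Hermitian products (`inner_smul_smul_of_norm`). -/
lemma exists_frame_zero (p : M) :
    ∃ c : ℂ, ‖c‖ = 1 ∧ (S.lagrangian p).frame.basis 0 = c • S.stiefelLift p := by
  obtain ⟨a, -, h⟩ := Quadric.rep_proj
    ⟨S.stiefelLift p, S.stiefelLift_ne_zero p, S.cBilin_stiefelLift p⟩
  have h1 : (S.lagrangian p).frame.basis 0 =
      (((‖(S.lagrangian p).rep.1‖⁻¹ : ℝ) : ℂ) * a) • S.stiefelLift p := by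
    rw [Quadric.frame_zero, mul_smul]
    exact congrArg _ h
  refine ⟨_, ?_, h1⟩
  have h2 := congrArg norm h1
  rw [norm_smul, S.norm_stiefelLift, mul_one, OrthonormalBasis.norm_eq_one] at h2
  exact h2.symm

lemma norm_scal_stiefelLift (p : M) :
    ‖(S.lagrangian p).frame.scal (S.stiefelLift p)‖ = 1 := by
  obtain ⟨c, hc, h⟩ := S.exists_frame_zero p
  change ‖inner ℂ ((S.lagrangian p).frame.basis 0) (S.stiefelLift p)‖ = 1
  rw [h, inner_smul_left, S.inner_stiefelLift_self, mul_one, RCLike.norm_conj, hc]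

lemma scal_stiefelLift_ne_zero (p : M) :
    (S.lagrangian p).frame.scal (S.stiefelLift p) ≠ 0 := fun h => by
  have := S.norm_scal_stiefelLift p
  simp [h] at this

lemma tangPart_stiefelLift (p : M) : (S.lagrangian p).frame.tangPart (S.stiefelLift p) = 0 := by
  obtain ⟨c, hc, h⟩ := S.exists_frame_zero p
  have hc0 : c ≠ 0 := fun h => by simp [h] at hc
  have h1 : (S.lagrangian p).frame.tangPart (c • S.stiefelLift p) = 0 := by
    rw [← h]
    ext i
    simp [IsotropicFrame.tangPart_apply, EuclideanSpace.single]
  rw [map_smul] at h1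
  exact (smul_eq_zero.1 h1).resolve_left hc0

variable [IsManifold (𝓡 n) ∞ M]

omit [IsManifold (𝓡 n) ∞ M] in
lemma mdifferentiableAt_stiefelLift (p : M) :
    MDifferentiableAt (𝓡 n) 𝓘(ℝ, CSpace n) S.stiefelLift p := by
  rw [stiefelLift_eq]
  exact mdifferentiableAt_stiefelComb (S.normalPair.mdiff p) (S.normalPair.mdiff_normal p)

lemma mvfderiv_stiefelLift (p : M) (v : TangentSpace (𝓡 n) p) :
    mvfderiv (𝓡 n) S.stiefelLift p v =
      stiefelComb (mvfderiv (𝓡 n) (fun q => (S.F q : RSpace n)) p v) (mvfderiv (𝓡 n) S.ν p v) := by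
  rw [stiefelLift_eq]
  exact mvfderiv_stiefelComb (S.normalPair.mdiff p) (S.normalPair.mdiff_normal p) v

/-- The lift is horizontal: the four products of F, ν with dF, dν all vanish. -/
lemma scal_mvfderiv_stiefelLift (p : M) (v : TangentSpace (𝓡 n) p) :
    (S.lagrangian p).frame.scal (mvfderiv (𝓡 n) S.stiefelLift p v) = 0 := by
  have H := S.normalPair
  obtain ⟨c, hc, h⟩ := S.exists_frame_zero p
  change inner ℂ ((S.lagrangian p).frame.basis 0) _ = 0
  rw [h, inner_smul_left, mvfderiv_stiefelLift, stiefelLift_eq, inner_stiefelComb,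
    H.inner_deriv_self, H.inner_normal_deriv_normal, H.inner_deriv_normal, real_inner_comm,
    H.normal]
  simp

/-- The second frame vector is the conjugate of the first, so the same four products occur. -/
lemma repr_one_mvfderiv_stiefelLift (p : M) (v : TangentSpace (𝓡 n) p) :
    (S.lagrangian p).frame.basis.repr (mvfderiv (𝓡 n) S.stiefelLift p v) 1 = 0 := by
  have H := S.normalPair
  obtain ⟨c, hc, h⟩ := S.exists_frame_zero p
  rw [OrthonormalBasis.repr_apply_apply, IsotropicFrame.conj, ← cBilin_eq_inner, h,
    cBilin_smul_left, cBilin_eq_inner, mvfderiv_stiefelLift, stiefelLift_eq, cConj_stiefelComb,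
    inner_stiefelComb, inner_neg_left, inner_neg_left,
    H.inner_deriv_self, H.inner_normal_deriv_normal, H.inner_deriv_normal,
    real_inner_comm _ (S.ν p), H.normal]
  simp

/-- Tangential derivatives are seen by the tangential part in the frame. -/
lemma inner_tangPart_mvfderiv (p : M) (x : CSpace n) (v : TangentSpace (𝓡 n) p) :
    inner ℂ ((S.lagrangian p).frame.tangPart x)
      ((S.lagrangian p).frame.tangPart (mvfderiv (𝓡 n) S.stiefelLift p v)) =
    inner ℂ x (mvfderiv (𝓡 n) S.stiefelLift p v) := by
  rw [IsotropicFrame.inner_eq (S.lagrangian p).frame x, ← IsotropicFrame.scal_apply _ (mvfderiv _ _ _ _),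
    scal_mvfderiv_stiefelLift, repr_one_mvfderiv_stiefelLift]
  simp

omit [IsManifold (𝓡 n) ∞ M] in
lemma extChartAt_lagrangian (p q : M) :
    extChartAt 𝓘(ℝ, EuclideanSpace ℂ (Fin n)) (S.lagrangian p) (S.lagrangian q) =
      (S.lagrangian p).frame.coord (S.stiefelLift q) :=
  IsotropicFrame.coord_rep _ _

omit [IsManifold (𝓡 n) ∞ M] in
lemma lagrangian_mem_chartAt_source_iff (p q : M) :
    S.lagrangian q ∈ (chartAt (EuclideanSpace ℂ (Fin n)) (S.lagrangian p)).source ↔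
      (S.lagrangian p).frame.scal (S.stiefelLift q) ≠ 0 := by
  rw [IsotropicFrame.scal_apply]
  exact IsotropicFrame.repr_rep_ne_zero_iff _ _

omit [IsManifold (𝓡 n) ∞ M] in
lemma eventually_scal_stiefelLift_ne_zero (p : M) :
    ∀ᶠ q in 𝓝 p, (S.lagrangian p).frame.scal (S.stiefelLift q) ≠ 0 :=
  (IsotropicFrame.mdifferentiableAt_scal _ (S.mdifferentiableAt_stiefelLift p)).continuousAt.eventually_ne
    (S.scal_stiefelLift_ne_zero p)

omit [IsManifold (𝓡 n) ∞ M] in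
lemma mdifferentiableAt_lagrangian (p : M) :
    MDifferentiableAt (𝓡 n) 𝓘(ℝ, EuclideanSpace ℂ (Fin n)) S.lagrangian p := by
  have h1 := (S.lagrangian p).frame.mdifferentiableAt_coord (S.mdifferentiableAt_stiefelLift p)
    (S.scal_stiefelLift_ne_zero p)
  have h2 := (mdifferentiableAt_extChartAt_symm (S.lagrangian p)
    (Quadric.mem_extChartAt_target (S.lagrangian p)
      ((S.lagrangian p).frame.coord (S.stiefelLift p)))).comp p h1
  refine h2.congr_of_eventuallyEq ?_
  filter_upwards [S.eventually_scal_stiefelLift_ne_zero p] with q hq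
  rw [Function.comp_apply, ← extChartAt_lagrangian, (extChartAt _ (S.lagrangian p)).left_inv]
  rw [extChartAt_source]
  exact (S.lagrangian_mem_chartAt_source_iff p q).2 hq

omit [IsManifold (𝓡 n) ∞ M] in
lemma tangentCoord_mfderiv_lagrangian {p q : M}
    (hq : (S.lagrangian p).frame.scal (S.stiefelLift q) ≠ 0) (v : TangentSpace (𝓡 n) q) :
    tangentCoord (S.lagrangian p) (S.lagrangian q)
      (mfderiv (𝓡 n) 𝓘(ℝ, EuclideanSpace ℂ (Fin n)) S.lagrangian q v) =
    mvfderiv (𝓡 n) (fun q => (S.lagrangian p).frame.coord (S.stiefelLift q)) q v := by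
  have h1 : MDifferentiableAt 𝓘(ℝ, EuclideanSpace ℂ (Fin n)) 𝓘(ℝ, EuclideanSpace ℂ (Fin n))
      (extChartAt 𝓘(ℝ, EuclideanSpace ℂ (Fin n)) (S.lagrangian p)) (S.lagrangian q) :=
    mdifferentiableAt_extChartAt ((S.lagrangian_mem_chartAt_source_iff p q).2 hq)
  have h2 := mfderiv_comp q h1 (S.mdifferentiableAt_lagrangian q)
  have h3 : (extChartAt 𝓘(ℝ, EuclideanSpace ℂ (Fin n)) (S.lagrangian p)) ∘ S.lagrangian =
      fun q => (S.lagrangian p).frame.coord (S.stiefelLift q) :=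
    funext fun q => S.extChartAt_lagrangian p q
  rw [← h3]
  exact (DFunLike.congr_fun h2 v).symm

lemma mfderiv_lagrangian (p : M) (v : TangentSpace (𝓡 n) p) :
    mfderiv (𝓡 n) 𝓘(ℝ, EuclideanSpace ℂ (Fin n)) S.lagrangian p v =
      ((S.lagrangian p).frame.scal (S.stiefelLift p))⁻¹ •
        (S.lagrangian p).frame.tangPart (mvfderiv (𝓡 n) S.stiefelLift p v) := by
  have h := S.tangentCoord_mfderiv_lagrangian (S.scal_stiefelLift_ne_zero p) v
  rw [tangentCoord_self, IsotropicFrame.mvfderiv_coord _ (S.mdifferentiableAt_stiefelLift p)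
    (S.scal_stiefelLift_ne_zero p), S.scal_mvfderiv_stiefelLift,
    mul_zero, zero_smul, sub_zero] at h
  exact h

omit [IsManifold (𝓡 n) ∞ M] in
lemma inner_smul_smul_of_norm {r : ℂ} (hr : ‖r‖ = 1) (x y : EuclideanSpace ℂ (Fin n)) :
    inner ℂ (r⁻¹ • x) (r⁻¹ • y) = inner ℂ x y := by
  rw [inner_smul_left, inner_smul_right, ← mul_assoc, mul_comm ((starRingEnd ℂ) r⁻¹),
    Complex.mul_conj, Complex.normSq_eq_norm_sq, norm_inv, hr]
  simp

lemma hatMetric_apply (p : M) (v w : TangentSpace (𝓡 n) p) :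
    S.hatMetric p v w = (1 / 2 : ℝ) *
      (inner ℝ (mvfderiv (𝓡 n) (fun q => (S.F q : RSpace n)) p v)
          (mvfderiv (𝓡 n) (fun q => (S.F q : RSpace n)) p w) +
        inner ℝ (mvfderiv (𝓡 n) S.ν p v) (mvfderiv (𝓡 n) S.ν p w)) := by
  refine (Quadric.kahlerMetric_apply _ _ _).trans ((congrArg₂
    (fun x y : EuclideanSpace ℂ (Fin n) => (inner ℂ x y : ℂ).re)
    (S.mfderiv_lagrangian p v) (S.mfderiv_lagrangian p w)).trans ?_)
  rw [inner_smul_smul_of_norm (S.norm_scal_stiefelLift p), inner_tangPart_mvfderiv,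
    mvfderiv_stiefelLift, mvfderiv_stiefelLift, inner_stiefelComb]
  simp

/-- ĝ(v, v) = 0 forces dF v = dν v = 0, hence dF_t v = 0. -/
lemma hatMetric_isInvertible {t : ℝ} (ht : t ∈ S.regularSet) (p : M) :
    (S.hatMetric p).IsInvertible := by
  refine isInvertible_of_nondegenerate (E := EuclideanSpace ℝ (Fin n)) (S.hatMetric p) ?_
  intro v hv
  have h := (S.hatMetric_apply p v v).symm.trans hv
  have h1 : inner ℝ (mvfderiv (𝓡 n) (fun q => (S.F q : RSpace n)) p v)
      (mvfderiv (𝓡 n) (fun q => (S.F q : RSpace n)) p v) = (0 : ℝ) := by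
    have h1 := real_inner_self_nonneg (x := mvfderiv (𝓡 n) (fun q => (S.F q : RSpace n)) p v)
    have h2 := real_inner_self_nonneg (x := mvfderiv (𝓡 n) S.ν p v)
    linarith
  have h2 : inner ℝ (mvfderiv (𝓡 n) S.ν p v) (mvfderiv (𝓡 n) S.ν p v) = (0 : ℝ) := by
    linarith
  refine ht p (Eq.trans ?_ (map_zero _).symm)
  refine (mvfderiv_smul_add_smul (S.normalPair.mdiff p) (S.normalPair.mdiff_normal p) _ _ v).trans ?_
  rw [inner_self_eq_zero.1 h1, inner_self_eq_zero.1 h2]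
  simp

/-- The covariant derivative of the normal field `N_X`. -/
lemma covDerivAlong_normalField (p : M) {X : (q : M) → TangentSpace (𝓡 n) q}
    (hX : MDifferentiableAt (𝓡 n) (𝓡 n) (fieldCoord p X) p) (v : TangentSpace (𝓡 n) p) :
    covDerivAlong (Quadric.kahlerMetric n) S.lagrangian (S.normalField X) p v =
      (-Complex.I) • ((S.lagrangian p).frame.scal (S.stiefelLift p))⁻¹ •
        (S.lagrangian p).frame.tangPart (stiefelComb
          (mvfderiv (𝓡 n) (fun q => mvfderiv (𝓡 n) (fun q => (S.F q : RSpace n)) q (X q)) p v)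
          (mvfderiv (𝓡 n) (fun q => mvfderiv (𝓡 n) S.ν q (X q)) p v)) := by
  have hF := mdifferentiableAt_mvfderiv_apply p S.normalPair.smooth hX
  have hν := mdifferentiableAt_mvfderiv_apply p S.normalPair.smooth_normal hX
  have hw : (fun q => mvfderiv (𝓡 n) S.stiefelLift q (X q)) = fun q => stiefelComb
      (mvfderiv (𝓡 n) (fun q => (S.F q : RSpace n)) q (X q)) (mvfderiv (𝓡 n) S.ν q (X q)) :=
    funext fun q => S.mvfderiv_stiefelLift q (X q)
  -- J is multiplication by i in this chart at all 𝔏(q) near 𝔏(p), so the constant −i comes out of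
  -- the derivative.
  have hev : (fun q => tangentCoord (S.lagrangian p) (S.lagrangian q) (S.normalField X q)) =ᶠ[𝓝 p]
      fun q => ((-Complex.I) • ContinuousLinearMap.id ℝ (EuclideanSpace ℂ (Fin n)))
        (mvfderiv (𝓡 n) (fun q => (S.lagrangian p).frame.coord (S.stiefelLift q)) q (X q)) := by
    filter_upwards [S.eventually_scal_stiefelLift_ne_zero p] with q hq
    have h1 := Quadric.tangentCoord_complexStructure
      ((S.lagrangian_mem_chartAt_source_iff p q).2 hq)
      (mfderiv (𝓡 n) 𝓘(ℝ, EuclideanSpace ℂ (Fin n)) S.lagrangian q (X q))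
    rw [S.tangentCoord_mfderiv_lagrangian hq] at h1
    have h2 : tangentCoord (S.lagrangian p) (S.lagrangian q) (S.normalField X q) =
      -tangentCoord (S.lagrangian p) (S.lagrangian q) ((S.lagrangian q).complexStructure
        (mfderiv (𝓡 n) 𝓘(ℝ, EuclideanSpace ℂ (Fin n)) S.lagrangian q (X q))) :=
      map_neg (tangentCoordL (S.lagrangian p) (S.lagrangian q)) _
    rw [h2, h1]
    simp
  obtain ⟨h1, h2⟩ := (S.lagrangian p).frame.mvfderiv_mvfderiv_coord S.mdifferentiableAt_stiefelLift
    (S.scal_stiefelLift_ne_zero p) (S.tangPart_stiefelLift p) (S.scal_mvfderiv_stiefelLift p)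
    (X := X) (by rw [hw]; exact mdifferentiableAt_stiefelComb hF hν) v
  rw [hw, mvfderiv_stiefelComb hF hν] at h2
  rw [Quadric.covDerivAlong_kahlerMetric, mvfderiv_congr hev, mvfderiv_clm_comp _ h1, h2]
  rfl

/-- The minus sign of the shape operator and the conjugate of −i turn the real part of the Hermitian
product into its imaginary part. Here X is the differentiated field and Y the direction, opposite to
`alpha_eq`. -/
lemma hatAlpha_eq {t : ℝ} (ht : t ∈ S.regularSet) {X : (p : M) → TangentSpace (𝓡 n) p}
    (Y Z : (p : M) → TangentSpace (𝓡 n) p) {p : M}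
    (hX : MDifferentiableAt (𝓡 n) (𝓡 n) (fieldCoord p X) p) :
    S.hatAlpha X Y Z p = (1 / 2 : ℝ) *
      (inner ℝ (mvfderiv (𝓡 n) (fun q => mvfderiv (𝓡 n) (fun q => (S.F q : RSpace n)) q (X q)) p (Y p))
        (mvfderiv (𝓡 n) S.ν p (Z p))
      - inner ℝ (mvfderiv (𝓡 n) (fun q => mvfderiv (𝓡 n) S.ν q (X q)) p (Y p))
        (mvfderiv (𝓡 n) (fun q => (S.F q : RSpace n)) p (Z p))) := by
  have h1 : S.hatAlpha X Y Z p = -(Quadric.kahlerMetric n (S.lagrangian p)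
      (covDerivAlong (Quadric.kahlerMetric n) S.lagrangian (S.normalField X) p (Y p))
      (mfderiv (𝓡 n) 𝓘(ℝ, EuclideanSpace ℂ (Fin n)) S.lagrangian p (Z p))) :=
    DFunLike.congr_fun ((S.hatMetric_isInvertible ht p).self_apply_inverse _) (Z p)
  rw [h1, Quadric.kahlerMetric_apply, covDerivAlong_normalField _ _ hX, mfderiv_lagrangian,
    inner_smul_left, inner_smul_smul_of_norm (S.norm_scal_stiefelLift p), inner_tangPart_mvfderiv,
    mvfderiv_stiefelLift, inner_stiefelComb]
  simp

/-- The cubic form `⟨D_X (dF Y), dν Z⟩ - ⟨D_X (dν Y), dF Z⟩` is symmetric in `X` and `Y`. -/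
lemma cubicForm_comm {X Y : (p : M) → TangentSpace (𝓡 n) p}
    (Z : (p : M) → TangentSpace (𝓡 n) p) {p : M}
    (hX : MDifferentiableAt (𝓡 n) (𝓡 n) (fieldCoord p X) p)
    (hY : MDifferentiableAt (𝓡 n) (𝓡 n) (fieldCoord p Y) p) :
    (inner ℝ (mvfderiv (𝓡 n) (fun q => mvfderiv (𝓡 n) (fun q => (S.F q : RSpace n)) q (Y q)) p (X p))
        (mvfderiv (𝓡 n) S.ν p (Z p))
      - inner ℝ (mvfderiv (𝓡 n) (fun q => mvfderiv (𝓡 n) S.ν q (Y q)) p (X p))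
        (mvfderiv (𝓡 n) (fun q => (S.F q : RSpace n)) p (Z p)) : ℝ) =
    inner ℝ (mvfderiv (𝓡 n) (fun q => mvfderiv (𝓡 n) (fun q => (S.F q : RSpace n)) q (X q)) p (Y p))
        (mvfderiv (𝓡 n) S.ν p (Z p))
      - inner ℝ (mvfderiv (𝓡 n) (fun q => mvfderiv (𝓡 n) S.ν q (X q)) p (Y p))
        (mvfderiv (𝓡 n) (fun q => (S.F q : RSpace n)) p (Z p)) := by
  -- Exchanging X and Y leaves two bracket terms, which cancel by symmetry of the second fundamental
  -- form.
  rw [mvfderiv_mvfderiv_comm p S.normalPair.smooth hX hY,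
    mvfderiv_mvfderiv_comm p S.normalPair.smooth_normal hX hY, inner_add_left, inner_add_left,
    S.normalPair.inner_deriv_comm, real_inner_comm (mvfderiv (𝓡 n) S.ν p (Z p))
      (mvfderiv (𝓡 n) (fun q => (S.F q : RSpace n)) p _)]
  ring

end IsoparametricHypersurface

end

theorem theoremA {n : ℕ} {M : Type*} [TopologicalSpace M]
    [ChartedSpace (EuclideanSpace ℝ (Fin n)) M] [IsManifold (𝓡 n) ∞ M] [ConnectedSpace M]
    (S : IsoparametricHypersurface n M) :
    (∀ t ∈ S.regularSet,
      ∀ X Y Z : Cₛ^∞⟮𝓡 n; EuclideanSpace ℝ (Fin n), (TangentSpace (𝓡 n) : M → Type)⟯,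
        ∀ p : M, S.alpha t X Y Z p = 2 * S.hatAlpha X Y Z p) ∧
    (∀ s ∈ S.regularSet, ∀ t ∈ S.regularSet,
      ∀ X Y Z : Cₛ^∞⟮𝓡 n; EuclideanSpace ℝ (Fin n), (TangentSpace (𝓡 n) : M → Type)⟯,
        ∀ p : M, S.alpha s X Y Z p = S.alpha t X Y Z p) := by
  refine ⟨fun t ht X Y Z p => ?_, fun s hs t ht X Y Z p => ?_⟩
  · rw [S.alpha_eq ht Z (mdifferentiableAt_fieldCoord Y p),
      S.hatAlpha_eq ht Y Z (mdifferentiableAt_fieldCoord X p),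
      S.cubicForm_comm Z (mdifferentiableAt_fieldCoord X p) (mdifferentiableAt_fieldCoord Y p)]
    ring
  · rw [S.alpha_eq hs Z (mdifferentiableAt_fieldCoord Y p),
      S.alpha_eq ht Z (mdifferentiableAt_fieldCoord Y p)]
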